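/- **Proposition 3.2 (Giambelli identity).** Let $R$ be a commutative $\mathbb{Q}$-algebra (for instance $\mathbb{C}$, or $\mathbb{C}[x_1,\dots,x_N]$). Let $\mathcal F$ be the fermionic Fock space over $R$, with basis the semi-infinite wedge products $e_{l_1}\wedge e_{l_2}\wedge\cdots$, where $l_1>l_2>\cdots$ are integers and the set $\{l_i\}$ contains all sufficiently negative integers. Let $\psi_j=e_j\wedge$ and $\psi_j^\dagger=i_{e^j}$ ($j\in\mathbb{Z}$) be the creation and annihilation operators on $\mathcal F$. For a partition $\lambda$ and $n\in\mathbb{Z}$ put $$|\lambda;n\rangle=e_{\lambda_1-1+n}\wedge e_{\lambda_2-2+n}\wedge\cdots,\qquad |n\rangle=|\emptyset;n\rangle ,$$ where $\lambda_i=0$ for $i$ greater than the length of $\lambda$, and let $\langle\lambda;n|$ be the dual basis vectors, with $\langle n|=\langle\emptyset;n|$. Let $\tilde A=(\tilde A_{jk})_{j,k\in\mathbb{Z}}$ be a strictly upper triangular matrix over $R$, i.e. $\tilde A_{jk}=0$ for $j\ge k$, and set $$\hat g(\tilde A)=\exp\Big(\sum_{j,k\in\mathbb{Z}}\tilde A_{jk}\,{:}\psi_j\psi_k^\dagger{:}\Big),\qquad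 {:}\psi_j\psi_k^\dagger{:}=\psi_j\psi_k^\dagger-\langle0|\psi_j\psi_k^\dagger|0\rangle,$$ $$\hat\gamma_+(\mathbf t)=\exp\Big(\sum_{j\ge1}t_jJ_j\Big),\qquad J_j=\sum_{k\in\mathbb{Z}}\psi_k\psi^\dagger_{k+j}.$$ All these sums, including the exponential series, have only finitely many nonzero terms on each basis vector. Define the polynomial $\tau$-function $$s_{\lambda,n}(\mathbf t|\tilde A)=\langle n|\,\hat\gamma_+(\mathbf t)\,\hat g(\tilde A)\,|\lambda;n\rangle .$$ For $N\ge0$ and $\mathbf x=(x_1,\dots,x_N)\in R^N$ let $[\mathbf x]=([\mathbf x]_1,[\mathbf x]_2,\dots)$ with $[\mathbf x]_j=\frac1j\sum_{a=1}^N x_a^j$. Then, for every $n\in\mathbb{Z}$, every $N\ge 0$, every $\mathbf x\in R^N$ and every partition $\lambda$ with Frobenius indices $(\alpha_1,\dots,\alpha_r|\beta_1,\dots,\beta_r)$ (so $r$ is the number of $i$ with $\lambda_i\ge i$, $\alpha_i=\lambda_i-i$ and $\beta_i=\lambda'_i-i$, with $\lambda'$ the conjugate partition), $$s_{\lambda,n}([\mathbf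 x]|\tilde A)=\det\big(s_{(\alpha_i|\beta_j),n}([\mathbf x]|\tilde A)\big)_{1\le i,j\le r},$$ where $(a|b)$ denotes the hook partition $(a+1,1^b)$, and the determinant is $1$ if $r=0$. -/

import Mathlib

noncomputable section

namespace Fermi

/-- The labels `l₁ > l₂ > ⋯` of the semi-infinite wedge products `e_{l₁} ∧ e_{l₂} ∧ ⋯`, recorded as
the set of occupied sites: a set of integers that is bounded above and contains all
sufficiently negative integers. -/
@[ext]
structure Maya where
  occ : Set ℤ
  bddAbove_occ : BddAbove occ
  bddBelow_compl : BddBelow occᶜ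

namespace Maya

/-- Add the site `j` to the occupied sites. -/
def add (S : Maya) (j : ℤ) : Maya where
  occ := insert j S.occ
  bddAbove_occ := S.bddAbove_occ.insert j
  bddBelow_compl := S.bddBelow_compl.mono
    (Set.compl_subset_compl.mpr (Set.subset_insert j S.occ))

/-- Remove the site `j` from the occupied sites. -/
def remove (S : Maya) (j : ℤ) : Maya where
  occ := S.occ \ {j}
  bddAbove_occ := S.bddAbove_occ.mono Set.sdiff_subset
  bddBelow_compl := by
    refine (S.bddBelow_compl.insert j).mono ?_
    intro k hk
    by_cases h : k = j
    · exact Or.inl h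
    · exact Or.inr fun hS => hk ⟨hS, h⟩

/-- The number of occupied sites above `j` (a finite number); `e_j` has to be moved past these
factors to reach, or to leave, its place in the wedge product. -/
def above (S : Maya) (j : ℤ) : ℕ := {k ∈ S.occ | j < k}.ncard

/-- The occupied sites `λ_i - i + n`, `i ≥ 1`, of the partition `lam` in the sector of charge `n`.
The rows of a Young diagram are numbered from `0`, whence the shift by one. -/
def ofPartition (lam : YoungDiagram) (n : ℤ) : Maya where
  occ := Set.range fun i : ℕ => (lam.rowLen i : ℤ) - ((i : ℤ) + 1) + n
  bddAbove_occ := by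
    refine ⟨(lam.rowLen 0 : ℤ) + n, ?_⟩
    rintro _ ⟨i, rfl⟩
    have h := lam.rowLen_anti 0 i (Nat.zero_le i)
    simp only
    omega
  bddBelow_compl := by
    refine ⟨n - (lam.colLen 0 : ℤ), ?_⟩
    intro k hk
    by_contra hlt
    apply hk
    refine ⟨(n - k - 1).toNat, ?_⟩
    have h0 : lam.rowLen (n - k - 1).toNat = 0 := by
      by_contra hne
      have h1 : ((n - k - 1).toNat, 0) ∈ lam :=
        YoungDiagram.mem_iff_lt_rowLen.mpr (Nat.pos_of_ne_zero hne)
      have h2 := YoungDiagram.mem_iff_lt_colLen.mp h1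
      omega
    simp only [h0]
    omega

end Maya

variable (R : Type*) [CommRing R]

/-- The fermionic Fock space: the direct sum of all charge sectors, with basis the semi-infinite
wedge products. -/
abbrev Fock := Maya →₀ R

variable {R}

/-- The basis vector `e_{l₁} ∧ e_{l₂} ∧ ⋯` of Fock space. -/
def ket (S : Maya) : Fock R := Finsupp.single S 1

/-- The basis vector `|λ; n⟩`. -/
def stateKet (lam : YoungDiagram) (n : ℤ) : Fock R := ket (Maya.ofPartition lam n)

/-- The dual basis vector `⟨λ; n|`. -/
def stateBra (lam : YoungDiagram) (n : ℤ) : Fock R →ₗ[R] R :=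
  Finsupp.lapply (Maya.ofPartition lam n)

/-- The vacuum `|n⟩ = |∅; n⟩ = e_{n-1} ∧ e_{n-2} ∧ ⋯`. -/
def vacKet (n : ℤ) : Fock R := stateKet ⊥ n

/-- The dual vacuum `⟨n|`. -/
def vacBra (n : ℤ) : Fock R →ₗ[R] R := stateBra ⊥ n

/-- The linear operator on Fock space with prescribed values on the basis. -/
def ofBasis (f : Maya → Fock R) : Module.End R (Fock R) := Finsupp.linearCombination R f

open Classical in
/-- The creation operator `ψ_j = e_j ∧`. -/
def psi (j : ℤ) : Module.End R (Fock R) :=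
  ofBasis fun S => if j ∈ S.occ then 0 else (-1 : R) ^ S.above j • ket (S.add j)

open Classical in
/-- The annihilation operator `ψ†_j`, the contraction with the dual basis vector `e^j`. -/
def psiDag (j : ℤ) : Module.End R (Fock R) :=
  ofBasis fun S => if j ∈ S.occ then (-1 : R) ^ S.above j • ket (S.remove j) else 0

/-- The normally ordered product `:ψ_j ψ†_k: = ψ_j ψ†_k - ⟨0| ψ_j ψ†_k |0⟩`. -/
def normalOrdered (j k : ℤ) : Module.End R (Fock R) :=
  psi j * psiDag k - vacBra (R := R) 0 ((psi j * psiDag k : Module.End R (Fock R)) (vacKet 0)) • 1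

/-- The sum of a (possibly infinite) family of operators, taken on each basis vector. It is
meaningful when the family is locally finite, as it is in all uses below when `A` is strictly upper
triangular (see the facts on well-definedness at the end). -/
def localSum {ι : Type*} (X : ι → Module.End R (Fock R)) : Module.End R (Fock R) :=
  ofBasis fun S => ∑ᶠ i, X i (ket S)

/-- A family of operators is locally finite if on each basis vector all but finitely many of them
vanish. -/
def LocallyFiniteFamily {ι : Type*} (X : ι → Module.End R (Fock R)) : Prop :=
  ∀ S : Maya, {i | X i (ket S) ≠ 0}.Finite

/-- The exponential series `∑ₘ X^m / m!` of an operator, taken on each basis vector. -/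
def expOp [Algebra ℚ R] (X : Module.End R (Fock R)) : Module.End R (Fock R) :=
  localSum fun m : ℕ => algebraMap ℚ R ((m.factorial : ℚ)⁻¹) • X ^ m

/-- The terms of the sum `∑_{j,k} A_{jk} :ψ_j ψ†_k:`. -/
def hatTerm (A : Matrix ℤ ℤ R) (p : ℤ × ℤ) : Module.End R (Fock R) :=
  A p.1 p.2 • normalOrdered p.1 p.2

/-- The fermionic representation `∑_{j,k} A_{jk} :ψ_j ψ†_k:` of the matrix `A`. -/
def hat (A : Matrix ℤ ℤ R) : Module.End R (Fock R) := localSum (hatTerm A)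

/-- The fermionic representation `e^{hat A}` of the group element `e^A`. -/
def gHat [Algebra ℚ R] (A : Matrix ℤ ℤ R) : Module.End R (Fock R) := expOp (hat A)

/-- The current component `J_j = ∑_k ψ_k ψ†_{k+j}`, `j ≥ 1`. -/
def current (j : ℕ+) : Module.End R (Fock R) :=
  localSum fun k : ℤ => psi k * psiDag (k + (j : ℕ))

/-- The generator `∑_{j ≥ 1} t_j J_j` of the flows. -/
def flowGenerator (t : ℕ+ → R) : Module.End R (Fock R) :=
  localSum fun j : ℕ+ => t j • current j

/-- The flow operator `exp (∑_{j ≥ 1} t_j J_j)`. -/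
def gammaPlus [Algebra ℚ R] (t : ℕ+ → R) : Module.End R (Fock R) := expOp (flowGenerator t)

/-- The `τ`-function `s_{λ,n}(t | A) = ⟨n| γ₊(t) ĝ(A) |λ; n⟩`. -/
def tau [Algebra ℚ R] (A : Matrix ℤ ℤ R) (lam : YoungDiagram) (n : ℤ) (t : ℕ+ → R) : R :=
  vacBra n ((gammaPlus t * gHat A) (stateKet lam n))

/-- The normalized power sums `[x]_j = (1/j) ∑_a x_a^j`, `j ≥ 1`. -/
def powerSums [Algebra ℚ R] {N : ℕ} (x : Fin N → R) (j : ℕ+) : R :=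
  algebraMap ℚ R (((j : ℕ) : ℚ)⁻¹) * ∑ a, x a ^ (j : ℕ)

/-- The Frobenius rank: the number of cells on the main diagonal. -/
def frobRank (lam : YoungDiagram) : ℕ := (lam.cells.filter fun c => c.1 = c.2).card

/-- The Frobenius index `α_i`: the number of cells to the right of the `i`-th diagonal cell
(counted from `0`, for `i < frobRank lam`). -/
def frobArm (lam : YoungDiagram) (i : ℕ) : ℕ := lam.rowLen i - (i + 1)

/-- The Frobenius index `β_i`: the number of cells below the `i`-th diagonal cell
(counted from `0`, for `i < frobRank lam`). -/
def frobLeg (lam : YoungDiagram) (i : ℕ) : ℕ := lam.colLen i - (i + 1)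

/-- The hook partition `(a|b)`, with parts `a + 1, 1, …, 1` where `1` occurs `b` times after the
first part. -/
def hook (a b : ℕ) : YoungDiagram :=
  YoungDiagram.ofRowLens ((a + 1) :: List.replicate b 1) (by
    refine List.Pairwise.sortedGE ?_
    simp [List.pairwise_cons, List.pairwise_replicate])

/-! ### Well-definedness of the infinite sums

All the infinite sums of operators above are locally finite when `A` is strictly upper triangular:
every term moves particles to lower sites only. -/

/-- The energy of a basis state relative to the vacuum configuration of negative sites. -/
def Maya.weight (S : Maya) (k : ℤ) : ℕ :=
  open Classical in if k ∈ S.occ then k.toNat else (-k).toNat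

/-- The total energy of a basis state. -/
def Maya.energy (S : Maya) : ℕ := ∑ᶠ k, S.weight k

theorem Maya.weight_finite (S : Maya) : (Function.support S.weight).Finite := by
  obtain ⟨a, ha⟩ := S.bddAbove_occ
  obtain ⟨b, hb⟩ := S.bddBelow_compl
  refine (Set.finite_Icc (min b 0) (max a 0)).subset ?_
  intro k hk
  simp only [Function.mem_support, Maya.weight] at hk
  split_ifs at hk with h
  · have := ha h
    exact ⟨by omega, by omega⟩
  · have := hb h
    exact ⟨by omega, by omega⟩

theorem Maya.energy_move (S : Maya) {j k : ℤ} (hjk : j < k) (hk : k ∈ S.occ) (hj : j ∉ S.occ) :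
    ((S.remove k).add j).energy < S.energy := by
  have hne : j ≠ k := by omega
  set T := (S.remove k).add j
  have hTocc : ∀ i, i ∈ T.occ ↔ i = j ∨ (i ∈ S.occ ∧ i ≠ k) := fun i => Iff.rfl
  let F : Finset ℤ := S.weight_finite.toFinset ∪ T.weight_finite.toFinset ∪ {j, k}
  have hS : S.energy = ∑ i ∈ F, S.weight i :=
    finsum_eq_sum_of_support_subset _ (fun i hi => by simp [F, Function.mem_support.mp hi])
  have hT : T.energy = ∑ i ∈ F, T.weight i :=
    finsum_eq_sum_of_support_subset _ (fun i hi => by simp [F, Function.mem_support.mp hi])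
  have hkF : k ∈ F := by simp [F]
  have hjF : j ∈ F.erase k := by simp [F, hne]
  rw [hS, hT, ← Finset.add_sum_erase F _ hkF, ← Finset.add_sum_erase F _ hkF,
    ← Finset.add_sum_erase _ _ hjF, ← Finset.add_sum_erase _ _ hjF]
  have hrest : ∑ i ∈ (F.erase k).erase j, T.weight i = ∑ i ∈ (F.erase k).erase j, S.weight i := by
    refine Finset.sum_congr rfl fun i hi => ?_
    simp only [Finset.mem_erase] at hi
    have hiff : i ∈ T.occ ↔ i ∈ S.occ := by simp [hTocc, hi.1, hi.2.1]
    by_cases h : i ∈ S.occ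
    · have h' := hiff.mpr h
      simp [Maya.weight, h, h']
    · have h' := mt hiff.mp h
      simp [Maya.weight, h, h']
  have h1 : T.weight k = (-k).toNat := by simp [Maya.weight, hTocc, hne.symm]
  have h2 : T.weight j = j.toNat := by simp [Maya.weight, hTocc]
  have h3 : S.weight k = k.toNat := by simp [Maya.weight, hk]
  have h4 : S.weight j = (-j).toNat := by simp [Maya.weight, hj]
  rw [hrest, h1, h2, h3, h4]
  omega

/-- An operator that lowers the energy of every basis state. -/
def Lowering (X : Module.End R (Fock R)) : Prop :=
  ∀ S : Maya, X (ket S) ∈ Finsupp.supported R R {T : Maya | T.energy < S.energy}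

theorem ofBasis_ket (f : Maya → Fock R) (S : Maya) : ofBasis f (ket S) = f S := by
  simp [ofBasis, ket]

theorem psi_psiDag_ket_of_ne {j k : ℤ} (hjk : j ≠ k) (S : Maya) :
    (psi j * psiDag k : Module.End R (Fock R)) (ket S) = 0 ∨
      (k ∈ S.occ ∧ j ∉ S.occ ∧ ∃ c : R,
        (psi j * psiDag k : Module.End R (Fock R)) (ket S) = c • ket ((S.remove k).add j)) := by
  by_cases hk : k ∈ S.occ
  · by_cases hj : j ∈ S.occ
    · left
      have : j ∈ (S.remove k).occ := ⟨hj, hjk⟩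
      simp [Module.End.mul_apply, psi, psiDag, ofBasis_ket, hk, this]
    · right
      have : j ∉ (S.remove k).occ := fun h => hj h.1
      refine ⟨hk, hj, (-1) ^ S.above k * (-1) ^ (S.remove k).above j, ?_⟩
      simp [Module.End.mul_apply, psi, psiDag, ofBasis_ket, hk, this, mul_smul]
  · left
    simp [Module.End.mul_apply, psiDag, ofBasis_ket, hk]

theorem normalOrdered_of_lt {j k : ℤ} (hjk : j < k) :
    (normalOrdered j k : Module.End R (Fock R)) = psi j * psiDag k := by
  have h : vacBra (R := R) 0 ((psi j * psiDag k : Module.End R (Fock R)) (vacKet 0)) = 0 := by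
    rcases psi_psiDag_ket_of_ne (R := R) hjk.ne (Maya.ofPartition ⊥ 0) with h | ⟨hk, hj, c, h⟩
    · rw [vacKet, stateKet, h, map_zero]
    · have hne : (Maya.ofPartition ⊥ 0 |>.remove k).add j ≠ Maya.ofPartition ⊥ 0 := by
        intro he
        have := Maya.energy_move _ hjk hk hj
        rw [he] at this
        exact lt_irrefl _ this
      rw [vacKet, stateKet, h, map_smul]
      simp [vacBra, stateBra, ket, hne]
  rw [normalOrdered, h, zero_smul]
  exact sub_zero (psi j * psiDag k : Module.End R (Fock R))

theorem lowering_psi_psiDag {j k : ℤ} (hjk : j < k) :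
    Lowering (psi j * psiDag k : Module.End R (Fock R)) := by
  intro S
  rcases psi_psiDag_ket_of_ne (R := R) hjk.ne S with h | ⟨hk, hj, c, h⟩
  · rw [h]; exact Submodule.zero_mem _
  · rw [h]
    exact Submodule.smul_mem _ _ (Finsupp.single_mem_supported R _ (S.energy_move hjk hk hj))

theorem Lowering.smul {X : Module.End R (Fock R)} (hX : Lowering X) (c : R) : Lowering (c • X) :=
  fun S => Submodule.smul_mem _ _ (hX S)

theorem lowering_localSum {ι : Type*} {X : ι → Module.End R (Fock R)} (hX : ∀ i, Lowering (X i)) :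
    Lowering (localSum X) := by
  intro S
  rw [localSum, ofBasis_ket]
  exact finsum_induction (· ∈ Finsupp.supported R R {T : Maya | T.energy < S.energy})
    (Submodule.zero_mem _) (fun _ _ => Submodule.add_mem _) fun i => hX i S

theorem finite_moves (S : Maya) : {p : ℤ × ℤ | p.1 < p.2 ∧ p.2 ∈ S.occ ∧ p.1 ∉ S.occ}.Finite := by
  obtain ⟨a, ha⟩ := S.bddAbove_occ
  obtain ⟨b, hb⟩ := S.bddBelow_compl
  refine ((Set.finite_Icc b a).prod (Set.finite_Icc b a)).subset ?_
  rintro ⟨j, k⟩ ⟨h, hk, hj⟩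
  have h1 := ha hk
  have h2 := hb hj
  simp only at h h1 h2
  exact ⟨⟨h2, by simp only; omega⟩, ⟨by simp only; omega, h1⟩⟩

/-- For strictly upper triangular `A` the sum defining `hat A` is locally finite. -/
theorem locallyFinite_hatTerm {A : Matrix ℤ ℤ R} (hA : ∀ i j : ℤ, j ≤ i → A i j = 0) :
    LocallyFiniteFamily (hatTerm A) := by
  intro S
  refine (finite_moves S).subset ?_
  rintro ⟨j, k⟩ hp
  rcases le_or_gt k j with h | h
  · exact absurd (by simp [hatTerm, hA j k h]) hp
  · rcases psi_psiDag_ket_of_ne (R := R) h.ne S with h0 | ⟨hk, hj, -⟩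
    · exact absurd (by simp only [hatTerm, normalOrdered_of_lt h, LinearMap.smul_apply, h0,
        smul_zero]) hp
    · exact ⟨h, hk, hj⟩

/-- For strictly upper triangular `A` the operator `hat A` lowers the energy. -/
theorem lowering_hat {A : Matrix ℤ ℤ R} (hA : ∀ i j : ℤ, j ≤ i → A i j = 0) : Lowering (hat A) := by
  refine lowering_localSum fun p => ?_
  rcases le_or_gt p.2 p.1 with h | h
  · intro S
    simp [hatTerm, hA p.1 p.2 h]
  · rw [hatTerm, normalOrdered_of_lt h]
    exact (lowering_psi_psiDag h).smul _

/-- The sum defining the current component `J_j` is locally finite. -/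
theorem locallyFinite_current (j : ℕ+) :
    LocallyFiniteFamily fun k : ℤ =>
      (psi k * psiDag (k + (j : ℕ)) : Module.End R (Fock R)) := by
  intro S
  have hj : (0 : ℤ) < (j : ℕ) := by exact_mod_cast j.pos
  refine ((finite_moves S).image Prod.fst).subset ?_
  intro k hk
  rcases psi_psiDag_ket_of_ne (R := R) (j := k) (k := k + (j : ℕ)) (by omega) S with
    h0 | ⟨h1, h2, -⟩
  · exact absurd h0 hk
  · exact ⟨(k, k + (j : ℕ)), ⟨by simp only; omega, h1, h2⟩, rfl⟩

/-- The sum `∑_{j ≥ 1} t_j J_j` is locally finite. -/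
theorem locallyFinite_flow (t : ℕ+ → R) :
    LocallyFiniteFamily fun j : ℕ+ => (t j • current j : Module.End R (Fock R)) := by
  intro S
  refine ((finite_moves S).image fun p => (p.2 - p.1).toNat.toPNat').subset ?_
  intro j hj
  by_contra hno
  apply hj
  have h0 : ∀ k : ℤ, (psi k * psiDag (k + (j : ℕ)) : Module.End R (Fock R)) (ket S) = 0 := by
    intro k
    have hpos : (0 : ℤ) < (j : ℕ) := by exact_mod_cast j.pos
    rcases psi_psiDag_ket_of_ne (R := R) (j := k) (k := k + (j : ℕ)) (by omega) S with
      h | ⟨h1, h2, -⟩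
    · exact h
    · refine absurd ⟨(k, k + (j : ℕ)), ⟨by simp only; omega, h1, h2⟩, ?_⟩ hno
      simp
  simp only [LinearMap.smul_apply, current, localSum, ofBasis_ket, h0, finsum_zero, smul_zero]

/-- The generator of the flows lowers the energy. -/
theorem lowering_flowGenerator (t : ℕ+ → R) : Lowering (flowGenerator t) := by
  refine lowering_localSum fun j => Lowering.smul (lowering_localSum fun k => ?_) _
  have hj : (0 : ℤ) < (j : ℕ) := by exact_mod_cast j.pos
  exact lowering_psi_psiDag (by omega)

theorem Lowering.pow_apply_ket {X : Module.End R (Fock R)} (hX : Lowering X) (m : ℕ) (S : Maya) :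
    (X ^ m) (ket S) ∈ Finsupp.supported R R {T : Maya | T.energy + m ≤ S.energy} := by
  induction m with
  | zero =>
    rw [pow_zero, Module.End.one_apply]
    refine Finsupp.single_mem_supported R (1 : R) ?_
    change S.energy + 0 ≤ S.energy
    omega
  | succ m ih =>
    rw [pow_succ', Module.End.mul_apply]
    generalize (X ^ m) (ket S) = v at ih
    rw [← Finsupp.sum_single v, Finsupp.sum, map_sum]
    refine Submodule.sum_mem _ fun T hT => ?_
    have h1 : T.energy + m ≤ S.energy := ih (Finset.mem_coe.mpr hT)
    have h2 : Finsupp.single T (v T) = v T • (ket T : Fock R) := by simp [ket]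
    rw [h2, map_smul]
    refine Submodule.smul_mem _ _ (Finsupp.supported_mono ?_ (hX T))
    intro U hU
    simp only [Set.mem_ofPred_eq] at hU ⊢
    omega

/-- The exponential series of an operator that lowers the energy is locally finite; with
`lowering_hat` and `lowering_flowGenerator` this covers `gHat` and `gammaPlus`. -/
theorem Lowering.locallyFinite_exp [Algebra ℚ R] {X : Module.End R (Fock R)} (hX : Lowering X) :
    LocallyFiniteFamily fun m : ℕ => algebraMap ℚ R ((m.factorial : ℚ)⁻¹) • X ^ m := by
  intro S
  refine (Set.finite_Iic S.energy).subset ?_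
  intro m hm
  by_contra hlt
  simp only [Set.mem_Iic, not_le] at hlt
  apply hm
  have h := hX.pow_apply_ket m S
  have he : {T : Maya | T.energy + m ≤ S.energy} = ∅ := by
    ext T
    simp only [Set.mem_ofPred_eq, Set.mem_empty_iff_false, iff_false]
    omega
  rw [he, Finsupp.supported_empty, Submodule.mem_bot] at h
  simp only [LinearMap.smul_apply, h, smul_zero]

end Fermi

end

noncomputable section

namespace Fermi

/-! ### Canonical anticommutation relations -/

namespace Maya

/-! The operator `G = gammaPlus t * gHat A` is the exponential image of a linear map `g` on
one-particle vectors: it satisfies `G ψ(v) = ψ(g v) G`, and it fixes every vacuum, because strictly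
triangular generators only move particles down. A state `|λ; n⟩` is, up to sign, a wedge of `p`
basis vectors over a deeper vacuum of charge `n - p`, so the τ-function is, up to the same sign, a
`p × p` minor of `g` (`gammaPlus_gHat_wedge`, `vacBra_wedge`, `tau_eq_det`).

In Frobenius form, `|λ; n⟩` arises from `|n⟩` by moving the particles at `n - 1 - β_i` to `n + α_i`
(`ofPartition_eq_frobMaya`). If each moved particle keeps its place in the wedge, the sign is
`(-1)^(∑ β_i)` (`wedge_frobSite`), and the minor for `λ` comes from the vacuum minor by replacing
the rows `β_i`. The vacuum minor is `⟨n| G |n⟩ = 1`. Expressing the new rows in the basis of the old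
ones leaves an `r × r` determinant, whose entries are, by Cramer's rule, the minors with a single
row replaced, that is, hooks up to sign (`det_replace_rows`). The signs factor out by columns.
Nothing depends on the times being power sums. -/

theorem mem_add {S : Maya} {i j : ℤ} : i ∈ (S.add j).occ ↔ i = j ∨ i ∈ S.occ := Iff.rfl

theorem mem_remove {S : Maya} {i j : ℤ} : i ∈ (S.remove j).occ ↔ i ∈ S.occ ∧ i ≠ j := Iff.rfl

theorem finite_above (S : Maya) (j : ℤ) : {k ∈ S.occ | j < k}.Finite := by
  obtain ⟨a, ha⟩ := S.bddAbove_occ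
  exact (Set.finite_Ioc j a).subset fun k hk => ⟨hk.2, ha hk.1⟩

theorem above_add {S : Maya} {k : ℤ} (hk : k ∉ S.occ) (j : ℤ) :
    (S.add k).above j = S.above j + if j < k then 1 else 0 := by
  unfold above
  split_ifs with h
  · rw [← Set.ncard_insert_of_notMem (a := k) (fun hm => hk hm.1) (S.finite_above j)]
    congr 1
    ext i
    simp only [Set.mem_ofPred_eq, mem_add, Set.mem_insert_iff]
    grind
  · rw [add_zero]
    congr 1
    ext i
    simp only [Set.mem_ofPred_eq, mem_add]
    grind

theorem add_remove {S : Maya} {k : ℤ} (hk : k ∈ S.occ) : (S.remove k).add k = S := by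
  ext i
  simp only [mem_add, mem_remove]
  grind

theorem remove_add {S : Maya} {k : ℤ} (hk : k ∉ S.occ) : (S.add k).remove k = S := by
  ext i
  simp only [mem_add, mem_remove]
  grind

theorem add_comm (S : Maya) (j k : ℤ) : (S.add j).add k = (S.add k).add j := by
  ext i
  simp only [mem_add]
  tauto

theorem remove_add_of_ne (S : Maya) {j k : ℤ} (hjk : j ≠ k) :
    (S.add j).remove k = (S.remove k).add j := by
  ext i
  simp only [mem_add, mem_remove]
  grind

theorem above_remove {S : Maya} {k : ℤ} (hk : k ∈ S.occ) (j : ℤ) :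
    S.above j = (S.remove k).above j + if j < k then 1 else 0 := by
  conv_lhs => rw [← add_remove hk]
  exact above_add (S := S.remove k) (fun h => h.2 rfl) j

end Maya

variable {R : Type*} [CommRing R]

theorem end_ext_ket {X Y : Module.End R (Fock R)} (h : ∀ S, X (ket S) = Y (ket S)) : X = Y :=
  Finsupp.lhom_ext' fun S => LinearMap.ext_ring (h S)

theorem psi_ket_of_mem {S : Maya} {j : ℤ} (h : j ∈ S.occ) : psi j (ket S : Fock R) = 0 := by
  simp [psi, ofBasis_ket, h]

theorem psi_ket_of_notMem {S : Maya} {j : ℤ} (h : j ∉ S.occ) :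
    psi j (ket S : Fock R) = (-1 : R) ^ S.above j • ket (S.add j) := by
  simp [psi, ofBasis_ket, h]

theorem psiDag_ket_of_mem {S : Maya} {j : ℤ} (h : j ∈ S.occ) :
    psiDag j (ket S : Fock R) = (-1 : R) ^ S.above j • ket (S.remove j) := by
  simp [psiDag, ofBasis_ket, h]

theorem psiDag_ket_of_notMem {S : Maya} {j : ℤ} (h : j ∉ S.occ) :
    psiDag j (ket S : Fock R) = 0 := by
  simp [psiDag, ofBasis_ket, h]

theorem psi_mul_self (j : ℤ) : (psi j * psi j : Module.End R (Fock R)) = 0 := by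
  refine end_ext_ket fun S => ?_
  rw [Module.End.mul_apply, LinearMap.zero_apply]
  by_cases h : j ∈ S.occ
  · rw [psi_ket_of_mem h, map_zero]
  · rw [psi_ket_of_notMem h, map_smul, psi_ket_of_mem (Maya.mem_add.2 (Or.inl rfl)), smul_zero]

theorem psi_mul_psi (j k : ℤ) :
    (psi j * psi k : Module.End R (Fock R)) = -(psi k * psi j) := by
  rcases eq_or_ne j k with rfl | hjk
  · rw [psi_mul_self]; exact (neg_zero (G := Module.End R (Fock R))).symm
  refine end_ext_ket fun S => ?_
  simp only [Module.End.mul_apply, LinearMap.neg_apply]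
  by_cases hj : j ∈ S.occ
  · rw [psi_ket_of_mem hj, map_zero, neg_zero]
    by_cases hk : k ∈ S.occ
    · rw [psi_ket_of_mem hk, map_zero]
    · rw [psi_ket_of_notMem hk, map_smul, psi_ket_of_mem (Maya.mem_add.2 (Or.inr hj)), smul_zero]
  · by_cases hk : k ∈ S.occ
    · rw [psi_ket_of_mem hk, map_zero, psi_ket_of_notMem hj, map_smul,
        psi_ket_of_mem (Maya.mem_add.2 (Or.inr hk)), smul_zero, neg_zero]
    · have hj' : j ∉ (S.add k).occ := by rw [Maya.mem_add]; tauto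
      have hk' : k ∉ (S.add j).occ := by rw [Maya.mem_add]; grind
      rw [psi_ket_of_notMem hk, psi_ket_of_notMem hj, map_smul, map_smul, psi_ket_of_notMem hj',
        psi_ket_of_notMem hk', Maya.above_add hk, Maya.above_add hj, S.add_comm j k, smul_smul,
        smul_smul, ← neg_smul]
      congr 1
      -- Only the lower of the two sites sees one more particle above it when the other is added
      -- first; this is the single sign between the two orders.
      rcases lt_or_gt_of_ne hjk with h | h
      · simp [h, h.le.not_gt, pow_succ, mul_comm]
      · simp [h, h.le.not_gt, pow_succ, mul_comm]

theorem psiDag_mul_psi (l k : ℤ) :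
    (psiDag l * psi k : Module.End R (Fock R)) =
      (if l = k then 1 else 0) - psi k * psiDag l := by
  refine end_ext_ket fun S => ?_
  simp only [Module.End.mul_apply, LinearMap.sub_apply]
  split_ifs with hlk
  · subst hlk
    rw [Module.End.one_apply]
    by_cases hl : l ∈ S.occ
    · have hl' : l ∉ (S.remove l).occ := fun h => h.2 rfl
      rw [psi_ket_of_mem hl, map_zero, psiDag_ket_of_mem hl, map_smul, psi_ket_of_notMem hl',
        Maya.above_remove hl, Maya.add_remove hl, smul_smul]
      simp [← mul_pow]
    · rw [psiDag_ket_of_notMem hl, map_zero, sub_zero, psi_ket_of_notMem hl, map_smul,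
        psiDag_ket_of_mem (Maya.mem_add.2 (Or.inl rfl)), Maya.above_add hl, Maya.remove_add hl,
        smul_smul]
      simp [← mul_pow]
  · rw [LinearMap.zero_apply, zero_sub]
    by_cases hk : k ∈ S.occ
    · rw [psi_ket_of_mem hk, map_zero]
      by_cases hl : l ∈ S.occ
      · rw [psiDag_ket_of_mem hl, map_smul,
          psi_ket_of_mem (Maya.mem_remove.2 ⟨hk, Ne.symm hlk⟩), smul_zero, neg_zero]
      · rw [psiDag_ket_of_notMem hl, map_zero, neg_zero]
    · by_cases hl : l ∈ S.occ
      · have hk' : k ∉ (S.remove l).occ := fun h => hk h.1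
        rw [psi_ket_of_notMem hk, psiDag_ket_of_mem hl, map_smul, map_smul,
          psiDag_ket_of_mem (Maya.mem_add.2 (Or.inr hl)), psi_ket_of_notMem hk',
          Maya.above_add hk, S.remove_add_of_ne (Ne.symm hlk), smul_smul, smul_smul, ← neg_smul,
          Maya.above_remove hl k]
        congr 1
        rcases lt_or_gt_of_ne hlk with h | h
        · simp [h, h.le.not_gt, pow_succ, mul_comm]
        · simp [h, h.le.not_gt, pow_succ, mul_comm]
      · have hl' : l ∉ (S.add k).occ := by rw [Maya.mem_add]; tauto
        rw [psi_ket_of_notMem hk, map_smul, psiDag_ket_of_notMem hl', psiDag_ket_of_notMem hl,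
          map_zero, smul_zero, neg_zero]

/-- The two anticommutation signs cancel, so a bilinear operator commutes with `psi k` up to one
creation operator. This is why bilinear operators act on wedges as derivations. -/
theorem psi_psiDag_psi_apply (j l k : ℤ) (w : Fock R) :
    psi j (psiDag l (psi k w)) =
      psi k (psi j (psiDag l w)) + if l = k then psi j w else 0 := by
  have h1 : psiDag l (psi k w) = (if l = k then w else 0) - psi k (psiDag l w) := by
    have h := LinearMap.congr_fun (psiDag_mul_psi l k) w
    rw [Module.End.mul_apply] at h
    rw [h, LinearMap.sub_apply, Module.End.mul_apply]
    split_ifs <;> simp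
  have h2 : psi j (psi k (psiDag l w)) = -psi k (psi j (psiDag l w)) :=
    LinearMap.congr_fun (psi_mul_psi j k) (psiDag l w)
  rw [h1, map_sub, h2, sub_neg_eq_add, add_comm]
  split_ifs <;> simp

/-! ### Locally finite sums -/

theorem LocallyFiniteFamily.finite {ι : Type*} {X : ι → Module.End R (Fock R)}
    (hX : LocallyFiniteFamily X) (w : Fock R) : (Function.support fun i => X i w).Finite := by
  induction w using Finsupp.induction_linear with
  | zero => simp
  | add f g hf hg =>
    refine (hf.union hg).subset fun i hi => ?_
    by_contra hno
    simp only [Set.mem_union, Function.mem_support, not_or, not_not] at hno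
    exact hi (by simp [hno.1, hno.2])
  | single S c =>
    refine (hX S).subset fun i hi h => hi ?_
    have : (Finsupp.single S c : Fock R) = c • ket S := by simp [ket]
    simp only [this, map_smul, h, smul_zero]

/-- `localSum` is prescribed on kets only; local finiteness is what makes the pointwise sum
additive, hence valid on every vector. -/
theorem LocallyFiniteFamily.localSum_apply {ι : Type*} {X : ι → Module.End R (Fock R)}
    (hX : LocallyFiniteFamily X) (w : Fock R) : localSum X w = ∑ᶠ i, X i w := by
  induction w using Finsupp.induction_linear with
  | zero => simp
  | add f g hf hg =>
    simp only [map_add, hf, hg]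
    exact (finsum_add_distrib (hX.finite f) (hX.finite g)).symm
  | single S c =>
    have : (Finsupp.single S c : Fock R) = c • ket S := by simp [ket]
    simp only [this, map_smul]
    rw [localSum, ofBasis_ket]
    exact smul_finsum' c (hX.finite (ket S))

/-! ### Creation operators of vectors -/

/-- The creation operator of a finite linear combination of the basis vectors `e_j`. -/
def psiVec : (ℤ →₀ R) →ₗ[R] Module.End R (Fock R) := Finsupp.linearCombination R psi

theorem psiVec_single (k : ℤ) (c : R) : psiVec (Finsupp.single k c) = c • psi k := by
  simp [psiVec]

theorem psiVec_single_apply (k : ℤ) (c : R) (w : Fock R) :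
    psiVec (Finsupp.single k c) w = c • psi k w := by
  rw [psiVec_single, LinearMap.smul_apply]

/-! ### States with a filled sea below a site. -/

theorem map_mem_of_mem_supported {M : Type*} [AddCommGroup M] [Module R M] {s : Set Maya}
    {N : Submodule R M} {X : Fock R →ₗ[R] M} (hX : ∀ S ∈ s, X (ket S) ∈ N) {w : Fock R}
    (hw : w ∈ Finsupp.supported R R s) : X w ∈ N := by
  rw [← Finsupp.sum_single w, Finsupp.sum, map_sum]
  refine Submodule.sum_mem _ fun S hS => ?_
  have h : Finsupp.single S (w S) = w S • (ket S : Fock R) := by simp [ket]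
  rw [h, map_smul]
  exact Submodule.smul_mem _ _ (hX S (hw (Finset.mem_coe.2 hS)))

/-- The span of the basis states in which all sites below `m` are occupied. -/
def filled (R : Type*) [CommRing R] (m : ℤ) : Submodule R (Fock R) :=
  Finsupp.supported R R {S : Maya | ∀ k < m, k ∈ S.occ}

theorem ket_mem_filled {m : ℤ} {S : Maya} (hS : ∀ k < m, k ∈ S.occ) :
    (ket S : Fock R) ∈ filled R m := Finsupp.single_mem_supported R _ hS

/-- Pauli exclusion. It permits dropping all components below `m` from a vector acting on `filled R
m`, and so replaces infinite columns of a matrix by finite ones. -/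
theorem psi_eq_zero_of_mem_filled {m j : ℤ} (hj : j < m) {w : Fock R} (hw : w ∈ filled R m) :
    psi j w = 0 := by
  have h := map_mem_of_mem_supported (N := (⊥ : Submodule R (Fock R))) (X := psi j) ?_ hw
  · simpa using h
  · intro S hS
    rw [psi_ket_of_mem (hS j hj)]
    exact Submodule.zero_mem _

theorem psi_mem_filled {m : ℤ} (j : ℤ) {w : Fock R} (hw : w ∈ filled R m) :
    psi j w ∈ filled R m := by
  refine map_mem_of_mem_supported (fun S hS => ?_) hw
  by_cases hj : j ∈ S.occ
  · rw [psi_ket_of_mem hj]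
    exact Submodule.zero_mem _
  · rw [psi_ket_of_notMem hj]
    exact Submodule.smul_mem _ _ (ket_mem_filled fun k hk => Or.inr (hS k hk))

theorem psiVec_mem_filled {m : ℤ} (v : ℤ →₀ R) {w : Fock R} (hw : w ∈ filled R m) :
    psiVec v w ∈ filled R m := by
  induction v using Finsupp.induction_linear with
  | zero => simp
  | add f g hf hg =>
    rw [map_add, LinearMap.add_apply]
    exact Submodule.add_mem _ hf hg
  | single k c =>
    rw [psiVec_single_apply]
    exact Submodule.smul_mem _ _ (psi_mem_filled k hw)

/-! ### Strictly upper triangular bilinear operators -/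

/-- The action of the strictly upper triangular part of `A` on vectors, truncated to the sites
`≥ m`. -/
def truncation (A : Matrix ℤ ℤ R) (m : ℤ) : Module.End R (ℤ →₀ R) :=
  Finsupp.linearCombination R fun k => ∑ j ∈ Finset.Ico m k, Finsupp.single j (A j k)

theorem truncation_single (A : Matrix ℤ ℤ R) (m k : ℤ) :
    truncation A m (Finsupp.single k 1) = ∑ j ∈ Finset.Ico m k, Finsupp.single j (A j k) := by
  simp [truncation]

/-- Each application lowers the site by at least one and keeps only sites `≥ m`, so fewer than `(k -
m).toNat + 1` applications can survive. -/
theorem truncation_pow_single (A : Matrix ℤ ℤ R) (m : ℤ) (i : ℕ) :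
    ∀ k : ℤ, (k - m).toNat < i → (truncation A m ^ i) (Finsupp.single k 1) = 0 := by
  induction i with
  | zero => intro k hk; omega
  | succ i ih =>
    intro k hk
    rw [pow_succ, Module.End.mul_apply, truncation_single, map_sum]
    refine Finset.sum_eq_zero fun j hj => ?_
    rw [Finset.mem_Ico] at hj
    rw [← mul_one (A j k), ← smul_eq_mul, ← Finsupp.smul_single, map_smul, ih j (by omega),
      smul_zero]

theorem hatTerm_apply_of_lt (A : Matrix ℤ ℤ R) {p : ℤ × ℤ} (h : p.1 < p.2) (w : Fock R) :
    hatTerm A p w = A p.1 p.2 • psi p.1 (psiDag p.2 w) := by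
  rw [hatTerm, normalOrdered_of_lt h, LinearMap.smul_apply, Module.End.mul_apply]

theorem hatTerm_psi {A : Matrix ℤ ℤ R} (hA : ∀ i j : ℤ, j ≤ i → A i j = 0)
    (p : ℤ × ℤ) (k : ℤ) (w : Fock R) :
    hatTerm A p (psi k w) =
      psi k (hatTerm A p w) + if p.2 = k then A p.1 p.2 • psi p.1 w else 0 := by
  rcases le_or_gt p.2 p.1 with h | h
  · simp [hatTerm, hA _ _ h]
  · rw [hatTerm_apply_of_lt A h, hatTerm_apply_of_lt A h, psi_psiDag_psi_apply, smul_add, map_smul]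
    split_ifs <;> simp

/-- The commutator is column `k` of `A` turned into creation operators. Triangularity bounds its
sites above by `k`, and the filled sea of `w` bounds them below by `m`. -/
theorem hat_psi {A : Matrix ℤ ℤ R} (hA : ∀ i j : ℤ, j ≤ i → A i j = 0)
    {m : ℤ} (k : ℤ) {w : Fock R} (hw : w ∈ filled R m) :
    hat A (psi k w) = psi k (hat A w) + psiVec (truncation A m (Finsupp.single k 1)) w := by
  have hsub : (Function.support fun p : ℤ × ℤ => if p.2 = k then A p.1 p.2 • psi p.1 w else 0) ⊆
      ((Finset.Ico m k).map ⟨fun j => (j, k), fun a b h => (Prod.ext_iff.1 h).1⟩ :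
        Finset (ℤ × ℤ)) := by
    rintro ⟨j, l⟩ hp
    simp only [Function.mem_support, ne_eq, ite_eq_right_iff, not_forall] at hp
    obtain ⟨rfl, hp⟩ := hp
    have h1 : j < l := by
      by_contra h
      exact hp (by rw [hA j l (not_lt.1 h), zero_smul])
    have h2 : m ≤ j := by
      by_contra h
      exact hp (by rw [psi_eq_zero_of_mem_filled (not_le.1 h) hw, smul_zero])
    exact Finset.mem_coe.2 (Finset.mem_map.2 ⟨j, Finset.mem_Ico.2 ⟨h2, h1⟩, rfl⟩)
  have hlf := locallyFinite_hatTerm hA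
  rw [hat, hlf.localSum_apply, hlf.localSum_apply, map_finsum (psi k) (hlf.finite w)]
  simp only [hatTerm_psi hA]
  rw [finsum_add_distrib, finsum_eq_sum_of_support_subset _ hsub, truncation_single, map_sum,
    LinearMap.sum_apply, Finset.sum_map]
  · simp only [psiVec_single_apply]
    exact congrArg _ (Finset.sum_congr rfl fun j _ => if_pos rfl)
  · exact (hlf.finite w).subset fun p hp h => hp (by simp only [h, map_zero])
  · exact (Finset.finite_toSet _).subset hsub

/-- A particle below `m` cannot move down: the target would be a vacant site below `m`. -/
theorem hat_mem_filled {A : Matrix ℤ ℤ R} (hA : ∀ i j : ℤ, j ≤ i → A i j = 0)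
    {m : ℤ} {w : Fock R} (hw : w ∈ filled R m) : hat A w ∈ filled R m := by
  refine map_mem_of_mem_supported (fun S hS => ?_) hw
  rw [hat, localSum, ofBasis_ket]
  refine finsum_induction (· ∈ filled R m) (Submodule.zero_mem _)
    (fun _ _ => Submodule.add_mem _) fun p => ?_
  rcases le_or_gt p.2 p.1 with h | h
  · simp [hatTerm, hA _ _ h]
  · rw [hatTerm, normalOrdered_of_lt h, LinearMap.smul_apply]
    refine Submodule.smul_mem _ _ ?_
    rcases psi_psiDag_ket_of_ne (R := R) h.ne S with h0 | ⟨hk, hj, c, h0⟩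
    · rw [h0]
      exact Submodule.zero_mem _
    · rw [h0]
      refine Submodule.smul_mem _ _ (ket_mem_filled fun i hi => Or.inr ⟨hS i hi, ?_⟩)
      rintro rfl
      exact hj (hS _ (h.trans hi))

/-! ### Vacua. -/

theorem mem_ofPartition_bot {m k : ℤ} : k ∈ (Maya.ofPartition ⊥ m).occ ↔ k < m := by
  have h0 : ∀ i, (⊥ : YoungDiagram).rowLen i = 0 := fun i => by
    by_contra h
    exact YoungDiagram.notMem_bot (i, 0)
      (YoungDiagram.mem_iff_lt_rowLen.2 (Nat.pos_of_ne_zero h))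
  simp only [Maya.ofPartition, Set.mem_range, h0]
  constructor
  · rintro ⟨i, rfl⟩
    omega
  · intro h
    exact ⟨(m - k - 1).toNat, by omega⟩

theorem vacKet_mem_filled (m : ℤ) : (vacKet m : Fock R) ∈ filled R m :=
  ket_mem_filled fun _ hk => mem_ofPartition_bot.2 hk

theorem hat_vacKet {A : Matrix ℤ ℤ R} (hA : ∀ i j : ℤ, j ≤ i → A i j = 0) (m : ℤ) :
    hat A (vacKet m) = 0 := by
  rw [vacKet, stateKet, hat, localSum, ofBasis_ket]
  refine (finsum_congr fun p => ?_).trans finsum_zero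
  rcases le_or_gt p.2 p.1 with h | h
  · simp [hatTerm, hA _ _ h]
  · rw [hatTerm, normalOrdered_of_lt h, LinearMap.smul_apply]
    rcases psi_psiDag_ket_of_ne (R := R) h.ne (Maya.ofPartition ⊥ m) with h0 | ⟨hk, hj, -⟩
    · rw [h0, smul_zero]
    · rw [mem_ofPartition_bot] at hk hj
      omega

/-- The strictly upper triangular Toeplitz matrix of the flow with times `t`. -/
def toeplitz (t : ℕ+ → R) : Matrix ℤ ℤ R :=
  Matrix.of fun j k => if j < k then t (k - j).toNat.toPNat' else 0

theorem toeplitz_of_le (t : ℕ+ → R) (i j : ℤ) (h : j ≤ i) : toeplitz t i j = 0 := by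
  simp [toeplitz, h.not_gt]

/-- The map `(j, k) ↦ (k, k + j)` enumerates the strictly upper triangular positions. The flow
thereby becomes a case of `hat`, and everything proved for `hat A` applies to it. -/
theorem flowGenerator_eq_hat (t : ℕ+ → R) : flowGenerator t = hat (toeplitz t) := by
  refine end_ext_ket fun S => ?_
  rw [flowGenerator, localSum, hat, localSum, ofBasis_ket, ofBasis_ket]
  let e : ℕ+ × ℤ → ℤ × ℤ := fun q => (q.2, q.2 + (q.1 : ℕ))
  have he : Function.Injective e := by
    rintro ⟨a, b⟩ ⟨c, d⟩ h
    simp only [e, Prod.mk.injEq] at h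
    obtain ⟨rfl, h⟩ := h
    have : (a : ℕ) = c := by omega
    rw [PNat.coe_injective this]
  have hfin := (locallyFinite_hatTerm (toeplitz_of_le t)) S
  have hterm : ∀ q : ℕ+ × ℤ, hatTerm (toeplitz t) (e q) (ket S) =
      t q.1 • (psi q.2 * psiDag (q.2 + (q.1 : ℕ)) : Module.End R (Fock R)) (ket S) := by
    rintro ⟨a, k⟩
    have ha : k < k + (a : ℕ) := by
      have := a.pos
      omega
    have hta : (k + (a : ℕ) - k).toNat.toPNat' = a := by simp
    rw [hatTerm_apply_of_lt _ (by exact ha)]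
    simp only [e, toeplitz, Matrix.of_apply, ha, if_true, hta, Module.End.mul_apply]
  have hsupp : ∑ᶠ p, hatTerm (toeplitz t) p (ket S) =
      ∑ᶠ q : ℕ+ × ℤ, hatTerm (toeplitz t) (e q) (ket S) := by
    rw [← finsum_mem_range (f := fun p => hatTerm (toeplitz t) p (ket S)) he]
    refine finsum_congr fun p => ?_
    by_cases hp : p ∈ Set.range e
    · simp [hp]
    · have hle : p.2 ≤ p.1 := by
        by_contra h
        refine hp ⟨(⟨(p.2 - p.1).toNat, by omega⟩, p.1), Prod.ext rfl ?_⟩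
        simp only [e, PNat.mk_coe]
        omega
      simp [hp, hatTerm, toeplitz_of_le t _ _ hle]
  -- Finite support on the ket allows the double sum to be taken diagonal by diagonal.
  rw [hsupp, finsum_curry _ (hfin.preimage he.injOn)]
  refine finsum_congr fun a => ?_
  simp only [hterm]
  rw [LinearMap.smul_apply, current, localSum, ofBasis_ket]
  exact smul_finsum' _ (locallyFinite_current a S)

/-! ### Exponentials of bilinear operators -/

/-- `X` normalizes the creation operators on the states with all sites below `m` occupied, where
it acts on vectors as `B`, and it annihilates the vacuum of charge `m`. -/
structure ActsBy (X : Module.End R (Fock R)) (B : Module.End R (ℤ →₀ R)) (m : ℤ) : Prop where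
  lowering : Lowering X
  mem_filled : ∀ w ∈ filled R m, X w ∈ filled R m
  vacKet : X (vacKet m) = 0
  comm : ∀ (v : ℤ →₀ R), ∀ w ∈ filled R m, X (psiVec v w) = psiVec v (X w) + psiVec (B v) w

theorem actsBy_hat {A : Matrix ℤ ℤ R} (hA : ∀ i j : ℤ, j ≤ i → A i j = 0) (m : ℤ) :
    ActsBy (hat A) (truncation A m) m where
  lowering := lowering_hat hA
  mem_filled _ := hat_mem_filled hA
  vacKet := hat_vacKet hA m
  comm v w hw := by
    induction v using Finsupp.induction_linear with
    | zero => simp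
    | add f g hf hg =>
      simp only [map_add, LinearMap.add_apply, hf, hg]
      abel
    | single k c =>
      rw [← mul_one c, ← smul_eq_mul, ← Finsupp.smul_single, map_smul, map_smul, map_smul,
        LinearMap.smul_apply, LinearMap.smul_apply, map_smul, psiVec_single_apply, one_smul,
        hat_psi hA k hw, smul_add, psiVec_single_apply, one_smul, LinearMap.smul_apply]

namespace ActsBy

variable {X : Module.End R (Fock R)} {B : Module.End R (ℤ →₀ R)} {m : ℤ}

theorem pow_mem_filled (h : ActsBy X B m) (k : ℕ) {w : Fock R} (hw : w ∈ filled R m) :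
    (X ^ k) w ∈ filled R m := by
  induction k with
  | zero => simpa using hw
  | succ k ih =>
    rw [pow_succ', Module.End.mul_apply]
    exact h.mem_filled _ ih

/-- Leibniz rule for the derivation `X`, which differentiates the vector through `B` and the state
through `X`. -/
theorem pow_psiVec (h : ActsBy X B m) (k : ℕ) (v : ℤ →₀ R) {w : Fock R} (hw : w ∈ filled R m) :
    (X ^ k) (psiVec v w) =
      ∑ p ∈ Finset.HasAntidiagonal.antidiagonal k, k.choose p.1 • psiVec ((B ^ p.1) v) ((X ^ p.2) w) := by
  induction k with
  | zero => simp
  | succ k ih =>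
    rw [Finset.sum_antidiagonal_choose_succ_nsmul
      (fun i j => psiVec ((B ^ i) v) ((X ^ j) w)), pow_succ', Module.End.mul_apply, ih, map_sum,
      ← Finset.sum_add_distrib]
    refine Finset.sum_congr rfl fun p hp => ?_
    rw [map_nsmul, h.comm _ _ (h.pow_mem_filled _ hw), smul_add, pow_succ' X, pow_succ' B,
      Module.End.mul_apply, Module.End.mul_apply,
      Nat.choose_symm_of_eq_add (Finset.HasAntidiagonal.mem_antidiagonal.1 hp).symm]

end ActsBy

theorem truncation_locallyNilpotent (A : Matrix ℤ ℤ R) (m k : ℤ) :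
    ∃ K, ∀ i, K ≤ i → (truncation A m ^ i) (Finsupp.single k 1) = 0 :=
  ⟨(k - m).toNat + 1, fun i hi => truncation_pow_single A m i k (by omega)⟩

/-! ### Exponential series over a ℚ-algebra. -/

section RatAlgebra

variable [Algebra ℚ R]

/-- The reciprocal `1 / k!`. -/
def invFactorial (R : Type*) [CommRing R] [Algebra ℚ R] (k : ℕ) : R :=
  algebraMap ℚ R ((k.factorial : ℚ)⁻¹)

theorem invFactorial_mul_choose {i j k : ℕ} (h : i + j = k) :
    invFactorial R k * (k.choose i : R) = invFactorial R i * invFactorial R j := by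
  subst h
  rw [invFactorial, invFactorial, invFactorial, ← map_natCast (algebraMap ℚ R), ← map_mul,
    ← map_mul, Nat.cast_add_choose]
  congr 1
  have h1 := Nat.factorial_ne_zero i
  have h2 := Nat.factorial_ne_zero j
  have h3 := Nat.factorial_ne_zero (i + j)
  field_simp

theorem expOp_apply {X : Module.End R (Fock R)} (hX : Lowering X) (w : Fock R) :
    expOp X w = ∑ᶠ k : ℕ, invFactorial R k • (X ^ k) w :=
  hX.locallyFinite_exp.localSum_apply w

theorem finite_exp {X : Module.End R (Fock R)} (hX : Lowering X) (w : Fock R) :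
    (Function.support fun k : ℕ => invFactorial R k • (X ^ k) w).Finite :=
  hX.locallyFinite_exp.finite w

/-- The exponential series of an endomorphism, taken on each basis vector. -/
def expVec (B : Module.End R (ℤ →₀ R)) : Module.End R (ℤ →₀ R) :=
  Finsupp.linearCombination R fun k =>
    ∑ᶠ i : ℕ, invFactorial R i • (B ^ i) (Finsupp.single k 1)

/-- Cauchy product of two finite series. The square of side `K` that carries `f` lies within the
antidiagonals of index less than `2 * K`. -/
theorem finsum_sum_antidiagonal {M : Type*} [AddCommMonoid M] (f : ℕ → ℕ → M) (K : ℕ)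
    (h1 : ∀ i j, K ≤ i → f i j = 0) (h2 : ∀ i j, K ≤ j → f i j = 0) :
    ∑ᶠ k : ℕ, ∑ p ∈ Finset.HasAntidiagonal.antidiagonal k, f p.1 p.2 =
      ∑ i ∈ Finset.range K, ∑ j ∈ Finset.range K, f i j := by
  have hz : ∀ p : ℕ × ℕ, p ∉ Finset.range K ×ˢ Finset.range K → f p.1 p.2 = 0 := by
    intro p hp
    rw [Finset.mem_product, Finset.mem_range, Finset.mem_range, not_and_or, not_lt, not_lt] at hp
    exact hp.elim (h1 _ _) (h2 _ _)
  rw [finsum_eq_sum_of_support_subset (s := Finset.range (2 * K)), ← Finset.sum_product',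
    ← Finset.sum_fiberwise_of_maps_to (g := fun p : ℕ × ℕ => p.1 + p.2)
      (t := Finset.range (2 * K))]
  · refine Finset.sum_congr rfl fun k _ => ?_
    symm
    refine Finset.sum_subset ?_ ?_
    · intro p hp
      exact Finset.HasAntidiagonal.mem_antidiagonal.2 (Finset.mem_filter.1 hp).2
    · intro p hp hp'
      refine hz p fun hm => hp' (Finset.mem_filter.2 ⟨hm, Finset.HasAntidiagonal.mem_antidiagonal.1 hp⟩)
  · intro p hp
    simp only [Finset.mem_product, Finset.mem_range] at hp ⊢
    omega
  · intro k hk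
    by_contra hno
    refine hk (Finset.sum_eq_zero fun p hp => hz p fun hm => hno ?_)
    simp only [Finset.mem_product, Finset.mem_range, Finset.HasAntidiagonal.mem_antidiagonal,
      Finset.mem_coe] at hm hp ⊢
    omega

theorem finite_subset_range {s : Set ℕ} (hs : s.Finite) : ∃ K, ∀ k, K ≤ k → k ∉ s := by
  obtain ⟨b, hb⟩ := hs.bddAbove
  exact ⟨b + 1, fun k hk hks => absurd (hb hks) (by omega)⟩

theorem finsum_eq_sum_range {M : Type*} [AddCommMonoid M] {f : ℕ → M} {K : ℕ}
    (h : ∀ k, K ≤ k → f k = 0) : ∑ᶠ k, f k = ∑ k ∈ Finset.range K, f k :=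
  finsum_eq_sum_of_support_subset _ fun k hk => by
    by_contra hno
    exact hk (h k (by simpa using hno))

/-- Dividing the Leibniz rule by `k!` turns it into a Cauchy product. Both factors are finite sums:
the one on vectors since `B` is locally nilpotent, the one on states since `X` lowers the energy. -/
theorem ActsBy.expOp_psiVec {X : Module.End R (Fock R)} {B : Module.End R (ℤ →₀ R)} {m : ℤ}
    (h : ActsBy X B m)
    (hB : ∀ k, ∃ K, ∀ i, K ≤ i → (B ^ i) (Finsupp.single k 1) = 0)
    (v : ℤ →₀ R) {w : Fock R} (hw : w ∈ filled R m) :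
    expOp X (psiVec v w) = psiVec (expVec B v) (expOp X w) := by
  induction v using Finsupp.induction_linear with
  | zero => simp
  | add f g hf hg => simp only [map_add, LinearMap.add_apply, hf, hg]
  | single k c =>
    rw [← mul_one c, ← smul_eq_mul, ← Finsupp.smul_single, map_smul, map_smul, map_smul,
        LinearMap.smul_apply, LinearMap.smul_apply, map_smul]
    congr 1
    set v : ℤ →₀ R := Finsupp.single k 1 with hv
    obtain ⟨K₁, hK₁⟩ := hB k
    obtain ⟨K₂, hK₂⟩ := finite_subset_range (finite_exp h.lowering w)
    have hK₂' : ∀ j, K₂ ≤ j → invFactorial R j • (X ^ j) w = 0 := fun j hj => by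
      simpa using hK₂ j hj
    have hG : expVec B v = ∑ᶠ i : ℕ, invFactorial R i • (B ^ i) v := by
      simp [expVec, hv]
    have hK : ∀ i, max K₁ K₂ ≤ i → invFactorial R i • (B ^ i) v = 0 := fun i hi => by
      rw [hK₁ i (le_trans (le_max_left _ _) hi), smul_zero]
    have hK' : ∀ i, max K₁ K₂ ≤ i → invFactorial R i • (X ^ i) w = 0 := fun i hi =>
      hK₂' i (le_trans (le_max_right _ _) hi)
    rw [hG, expOp_apply h.lowering, expOp_apply h.lowering, finsum_eq_sum_range hK,
      finsum_eq_sum_range hK']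
    have hterm : ∀ k : ℕ, invFactorial R k • (X ^ k) (psiVec v w) =
        ∑ p ∈ Finset.HasAntidiagonal.antidiagonal k, psiVec (invFactorial R p.1 • (B ^ p.1) v)
          (invFactorial R p.2 • (X ^ p.2) w) := fun k => by
      rw [h.pow_psiVec k v hw, Finset.smul_sum]
      refine Finset.sum_congr rfl fun p hp => ?_
      rw [LinearMap.map_smul (psiVec _), LinearMap.map_smul psiVec, LinearMap.smul_apply,
        smul_smul, mul_comm (invFactorial R p.2),
        ← invFactorial_mul_choose (Finset.HasAntidiagonal.mem_antidiagonal.1 hp), mul_smul,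
        Nat.cast_smul_eq_nsmul]
    simp only [hterm]
    rw [finsum_sum_antidiagonal (fun i j => psiVec (invFactorial R i • (B ^ i) v)
      (invFactorial R j • (X ^ j) w)) (max K₁ K₂)]
    · simp only [map_sum, LinearMap.sum_apply]
      exact Finset.sum_comm
    · intro i j hi
      rw [hK i hi, map_zero, LinearMap.zero_apply]
    · intro i j hj
      rw [hK' j hj, map_zero]

theorem ActsBy.expOp_vacKet {X : Module.End R (Fock R)} {B : Module.End R (ℤ →₀ R)} {m : ℤ}
    (h : ActsBy X B m) : expOp X (Fermi.vacKet m) = Fermi.vacKet m := by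
  -- Only the constant term of the exponential survives on the vacuum.
  rw [expOp_apply h.lowering, finsum_eq_sum_range (K := 1)]
  · simp [invFactorial]
  · intro k hk
    obtain ⟨k, rfl⟩ := Nat.exists_eq_add_of_le' hk
    rw [pow_succ, Module.End.mul_apply, h.vacKet, map_zero, smul_zero]

theorem ActsBy.expOp_mem_filled {X : Module.End R (Fock R)} {B : Module.End R (ℤ →₀ R)} {m : ℤ}
    (h : ActsBy X B m) {w : Fock R} (hw : w ∈ filled R m) : expOp X w ∈ filled R m := by
  rw [expOp_apply h.lowering]
  exact finsum_induction (· ∈ filled R m) (Submodule.zero_mem _)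
    (fun _ _ => Submodule.add_mem _) fun k => Submodule.smul_mem _ _ (h.pow_mem_filled k hw)

/-- The action on vectors of `gammaPlus t * gHat A`, truncated to the sites `≥ m`. -/
def groupVec (A : Matrix ℤ ℤ R) (t : ℕ+ → R) (m : ℤ) : Module.End R (ℤ →₀ R) :=
  expVec (truncation (toeplitz t) m) * expVec (truncation A m)

section group

variable {A : Matrix ℤ ℤ R} (t : ℕ+ → R) (m : ℤ)

/-- The two intertwining relations compose because the first exponential preserves `filled R m`,
where the second relation is available. -/
theorem gammaPlus_gHat_psiVec (hA : ∀ i j : ℤ, j ≤ i → A i j = 0) (v : ℤ →₀ R) {w : Fock R}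
    (hw : w ∈ filled R m) :
    (gammaPlus t * gHat A) (psiVec v w) =
      psiVec (groupVec A t m v) ((gammaPlus t * gHat A) w) := by
  have h1 := actsBy_hat hA m
  have h2 := actsBy_hat (toeplitz_of_le t) m
  rw [Module.End.mul_apply, Module.End.mul_apply, gammaPlus, gHat, flowGenerator_eq_hat,
    h1.expOp_psiVec (truncation_locallyNilpotent A m) v hw,
    h2.expOp_psiVec (truncation_locallyNilpotent _ m) _ (h1.expOp_mem_filled hw)]
  rfl

theorem gammaPlus_gHat_vacKet (hA : ∀ i j : ℤ, j ≤ i → A i j = 0) :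
    (gammaPlus t * gHat A) (vacKet m) = vacKet m := by
  rw [Module.End.mul_apply, gammaPlus, gHat, flowGenerator_eq_hat, (actsBy_hat hA m).expOp_vacKet,
    (actsBy_hat (toeplitz_of_le t) m).expOp_vacKet]

end group

end RatAlgebra

/-! ### Wedge products of vectors over a vacuum -/

theorem psiVec_psiVec (f g : ℤ →₀ R) (w : Fock R) :
    psiVec f (psiVec g w) = -psiVec g (psiVec f w) := by
  induction f using Finsupp.induction_linear with
  | zero => simp
  | add f₁ f₂ h₁ h₂ =>
    simp only [map_add, LinearMap.add_apply, h₁, h₂]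
    abel
  | single j c =>
    induction g using Finsupp.induction_linear with
    | zero => simp
    | add g₁ g₂ h₁ h₂ =>
      simp only [map_add, LinearMap.add_apply, h₁, h₂]
      abel
    | single k d =>
      have h : psi j (psi k w) = -psi k (psi j w) := LinearMap.congr_fun (psi_mul_psi j k) w
      simp only [psiVec_single_apply, map_smul, h, smul_neg]
      rw [smul_comm]

/-- Anticommutation cancels the cross terms, and `psi j` squares to zero on its own; no division by
two is involved. -/
theorem psiVec_psiVec_self (f : ℤ →₀ R) (w : Fock R) : psiVec f (psiVec f w) = 0 := by
  induction f using Finsupp.induction_linear with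
  | zero => simp
  | add f₁ f₂ h₁ h₂ =>
    simp only [map_add, LinearMap.add_apply, h₁, h₂, psiVec_psiVec f₁ f₂]
    abel
  | single j c =>
    have h : psi j (psi j w) = 0 := LinearMap.congr_fun (psi_mul_self j) w
    simp only [psiVec_single_apply, map_smul, h, smul_zero]

/-- The relation needed for the universal property of the exterior algebra, which then supplies
multilinearity and alternation of `wedge`. -/
theorem psiVec_mul_self (f : ℤ →₀ R) : psiVec f * psiVec f = 0 :=
  LinearMap.ext fun w => psiVec_psiVec_self f w

/-- The wedge product `v_0 ∧ ⋯ ∧ v_{p-1} ∧ |m⟩`. -/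
def wedge (p : ℕ) (m : ℤ) : (ℤ →₀ R) [⋀^Fin p]→ₗ[R] Fock R :=
  ((LinearMap.applyₗ (vacKet m)).comp
    (ExteriorAlgebra.lift R ⟨psiVec, psiVec_mul_self⟩).toLinearMap).compAlternatingMap
      (ExteriorAlgebra.ιMulti R p)

theorem wedge_zero (m : ℤ) (v : Fin 0 → ℤ →₀ R) : wedge 0 m v = vacKet m := by
  simp [wedge]

theorem wedge_succ (p : ℕ) (m : ℤ) (v : Fin (p + 1) → ℤ →₀ R) :
    wedge (p + 1) m v = psiVec (v 0) (wedge p m (Fin.tail v)) := by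
  simp only [wedge, LinearMap.compAlternatingMap_apply, LinearMap.comp_apply,
    AlgHom.toLinearMap_apply]
  rw [ExteriorAlgebra.ιMulti_succ_apply, map_mul, ExteriorAlgebra.lift_ι_apply]
  rfl

theorem wedge_mem_filled (p : ℕ) (m : ℤ) (v : Fin p → ℤ →₀ R) : wedge p m v ∈ filled R m := by
  induction p with
  | zero =>
    rw [wedge_zero]
    exact vacKet_mem_filled m
  | succ p ih =>
    rw [wedge_succ]
    exact psiVec_mem_filled _ (ih _)

theorem gammaPlus_gHat_wedge [Algebra ℚ R] {A : Matrix ℤ ℤ R}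
    (hA : ∀ i j : ℤ, j ≤ i → A i j = 0) (t : ℕ+ → R) (p : ℕ) (m : ℤ) (v : Fin p → ℤ →₀ R) :
    (gammaPlus t * gHat A) (wedge p m v) = wedge p m fun i => groupVec A t m (v i) := by
  induction p with
  | zero => rw [wedge_zero, wedge_zero, gammaPlus_gHat_vacKet t m hA]
  | succ p ih =>
    rw [wedge_succ, wedge_succ, gammaPlus_gHat_psiVec t m hA _ (wedge_mem_filled p m _), ih]
    rfl

theorem wedge_single_mem_supported (p : ℕ) (m : ℤ) (c : Fin p → ℤ) :
    wedge p m (fun i => Finsupp.single (c i) (1 : R)) ∈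
      Finsupp.supported R R {S : Maya | ∀ i, c i ∈ S.occ} := by
  induction p with
  | zero =>
    rw [wedge_zero]
    exact Finsupp.single_mem_supported R (1 : R) fun i => i.elim0
  | succ p ih =>
    rw [wedge_succ, psiVec_single_apply, one_smul]
    refine map_mem_of_mem_supported (fun S hS => ?_) (ih (Fin.tail c))
    by_cases h : c 0 ∈ S.occ
    · rw [psi_ket_of_mem h]
      exact Submodule.zero_mem _
    · rw [psi_ket_of_notMem h]
      refine Submodule.smul_mem _ _ (Finsupp.single_mem_supported R (1 : R) fun i => ?_)
      refine Fin.cases ?_ (fun i => ?_) i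
      · exact Or.inl rfl
      · exact Or.inr (hS i)

theorem vacBra_eq_zero {n : ℤ} {w : Fock R} {s : Set Maya} (hs : Maya.ofPartition ⊥ n ∉ s)
    (hw : w ∈ Finsupp.supported R R s) : vacBra n w = 0 := by
  by_contra h
  exact hs (hw (Finset.mem_coe.2 (Finsupp.mem_support_iff.2 h)))

theorem wedge_eq_zero_of_lt (p : ℕ) (m : ℤ) (c : Fin p → ℤ) (i : Fin p) (h : c i < m) :
    wedge p m (fun i => Finsupp.single (c i) (1 : R)) = 0 := by
  induction p with
  | zero => exact i.elim0
  | succ p ih =>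
    rw [wedge_succ, psiVec_single_apply, one_smul]
    revert h
    refine Fin.cases ?_ (fun i => ?_) i
    · exact fun h => psi_eq_zero_of_mem_filled h (wedge_mem_filled p m _)
    · intro h
      have h0 := ih (Fin.tail c) i h
      change psi (c 0) (wedge p m fun i => Finsupp.single (Fin.tail c i) 1) = 0
      rw [h0, map_zero]

theorem ofPartition_bot_add (m : ℤ) :
    (Maya.ofPartition ⊥ m).add m = Maya.ofPartition ⊥ (m + 1) := by
  ext k
  rw [Maya.mem_add, mem_ofPartition_bot, mem_ofPartition_bot]
  omega

theorem above_ofPartition_bot {n b : ℤ} (hb : b < n) :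
    (Maya.ofPartition ⊥ n).above b = (n - 1 - b).toNat := by
  have h : {k ∈ (Maya.ofPartition ⊥ n).occ | b < k} = (Finset.Ioo b n : Finset ℤ) := by
    ext k
    rw [Set.mem_ofPred_eq, mem_ofPartition_bot, Finset.coe_Ioo, Set.mem_Ioo, and_comm]
  rw [Maya.above, h, Set.ncard_coe_finset, Int.card_Ioo]
  omega

theorem Maya.above_eq_zero {S : Maya} {a : ℤ} (h : ∀ k ∈ S.occ, k ≤ a) : S.above a = 0 := by
  rw [Maya.above, Set.ncard_eq_zero (S.finite_above a)]
  ext k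
  simp only [Set.mem_ofPred_eq, Set.mem_empty_iff_false, iff_false, not_and, not_lt]
  exact h k

theorem psi_vacKet (m : ℤ) : psi m (vacKet m : Fock R) = vacKet (m + 1) := by
  rw [vacKet, vacKet, stateKet, stateKet, psi_ket_of_notMem (by rw [mem_ofPartition_bot]; omega),
    ofPartition_bot_add, Maya.above_eq_zero, pow_zero, one_smul]
  intro k hk
  rw [mem_ofPartition_bot] at hk
  omega

/-- The sites are created from the lowest upwards, each on top of the previous vacuum, so no sign
appears. -/
theorem wedge_vacuum (p : ℕ) (m n : ℤ) (hn : n = m + p) :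
    wedge p m (fun i => Finsupp.single (n - 1 - (i : ℕ)) (1 : R)) = vacKet n := by
  induction p generalizing n with
  | zero =>
    rw [wedge_zero]
    congr 1
    simpa using hn.symm
  | succ p ih =>
    rw [wedge_succ, psiVec_single_apply, one_smul]
    have h := ih (n - 1) (by push_cast at hn; omega)
    have hf : (Fin.tail fun i : Fin (p + 1) => Finsupp.single (n - 1 - (i : ℕ)) (1 : R)) =
        fun i : Fin p => Finsupp.single (n - 1 - 1 - (i : ℕ)) (1 : R) := by
      funext i
      simp only [Fin.tail, Fin.val_succ]
      congr 1
      push_cast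
      omega
    rw [hf, h]
    have h1 := psi_vacKet (R := R) (n - 1)
    simp only [sub_add_cancel] at h1
    simpa using h1

theorem vacBra_vacKet (n : ℤ) : vacBra n (vacKet n : Fock R) = 1 := by
  simp [vacBra, stateBra, vacKet, stateKet, ket]

/-- The coordinates of a vector at the sites `n - 1, …, n - p`. -/
def vacCoord (p : ℕ) (n : ℤ) : (ℤ →₀ R) →ₗ[R] (Fin p → R) :=
  LinearMap.pi fun i => Finsupp.lapply (n - 1 - (i : ℕ))

/-- Both sides are alternating in `v`, so basis vectors at distinct sites suffice. If all sites lie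
in `[m, n)` they permute the vacuum sites, and both sides equal the sign of the permutation.
Otherwise both sides vanish. -/
theorem vacBra_wedge (p : ℕ) (m n : ℤ) (hn : n = m + p) (v : Fin p → ℤ →₀ R) :
    vacBra n (wedge p m v) = Matrix.det (Matrix.of fun i => vacCoord p n (v i)) := by
  suffices h : (vacBra n).compAlternatingMap (wedge p m) =
      (Matrix.detRowAlternating (R := R)).compLinearMap (vacCoord p n) by
    exact DFunLike.congr_fun h v
  refine Module.Basis.ext_alternating (Finsupp.basisSingleOne (R := R)) fun c hc => ?_
  simp only [Finsupp.coe_basisSingleOne, LinearMap.compAlternatingMap_apply]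
  by_cases hr : ∀ i, m ≤ c i ∧ c i < n
  · have hlt : ∀ i, (n - 1 - c i).toNat < p := fun i => by have := hr i; omega
    let σ : Fin p → Fin p := fun i => ⟨(n - 1 - c i).toNat, hlt i⟩
    have hσc : ∀ i, c i = n - 1 - ((σ i : Fin p) : ℕ) := fun i => by
      have := hr i
      simp only [σ]
      omega
    -- There are `p` distinct sites in an interval of length `p`.
    have hσ : Function.Bijective σ :=
      Finite.injective_iff_bijective.1 fun i j hij => hc (by rw [hσc i, hσc j, hij])
    let vac : Fin p → ℤ →₀ R := fun i => Finsupp.single (n - 1 - (i : ℕ)) 1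
    have hv : (fun i => Finsupp.single (c i) (1 : R)) = vac ∘ Equiv.ofBijective σ hσ := by
      funext i
      simp only [vac, Function.comp_apply, Equiv.ofBijective_apply, hσc i]
    rw [hv, AlternatingMap.map_perm, AlternatingMap.map_perm, wedge_vacuum p m n hn, map_zsmul_unit,
      vacBra_vacKet]
    congr 1
    rw [AlternatingMap.compLinearMap_apply]
    have h1 : (fun i => vacCoord p n (vac i)) = (1 : Matrix (Fin p) (Fin p) R) := by
      funext i j
      simp only [vacCoord, vac, LinearMap.pi_apply, Finsupp.lapply_apply, Finsupp.single_apply,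
        Matrix.one_apply]
      congr 1
      rw [eq_iff_iff, Fin.ext_iff]
      omega
    rw [h1]
    exact Matrix.det_one.symm
  · push Not at hr
    obtain ⟨i, hi⟩ := hr
    have hrow : vacCoord p n (Finsupp.single (c i) (1 : R)) = 0 := by
      funext j
      simp only [vacCoord, LinearMap.pi_apply, Finsupp.lapply_apply, Pi.zero_apply,
        Finsupp.single_apply]
      rw [if_neg]
      omega
    rw [AlternatingMap.compLinearMap_apply,
      AlternatingMap.map_coord_zero (Matrix.detRowAlternating (R := R)) i hrow]
    -- A site below `m` is already occupied in the sea; a site `≥ n` stays occupied in every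
    -- resulting state, unlike in `|n⟩`.
    rcases lt_or_ge (c i) m with h | h
    · rw [wedge_eq_zero_of_lt p m c i h, map_zero]
    · refine vacBra_eq_zero (fun hm => ?_) (wedge_single_mem_supported p m c)
      have h2 := mem_ofPartition_bot.1 (hm i)
      have h3 := hi h
      omega

/-! ### Moving a particle -/

theorem psi_psiDag_psiVec (a b : ℤ) (v : ℤ →₀ R) (w : Fock R) :
    psi a (psiDag b (psiVec v w)) =
      psiVec v (psi a (psiDag b w)) + psiVec (Finsupp.single a (v b)) w := by
  induction v using Finsupp.induction_linear with
  | zero => simp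
  | add f g hf hg =>
    simp only [map_add, LinearMap.add_apply, hf, hg, Finsupp.add_apply, Finsupp.single_add]
    abel
  | single k c =>
    simp only [psiVec_single_apply, map_smul, psi_psiDag_psi_apply, smul_add, Finsupp.single_apply,
      eq_comm (a := b)]
    split_ifs <;> simp

/-- A derivation acts on one factor at a time. The bound `m ≤ b` makes the contribution of the sea
vanish. -/
theorem psi_psiDag_wedge (a b : ℤ) (p : ℕ) (m : ℤ) (hb : m ≤ b) (v : Fin p → ℤ →₀ R) :
    psi a (psiDag b (wedge p m v)) =
      ∑ i, wedge p m (Function.update v i (Finsupp.single a (v i b))) := by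
  induction p with
  | zero =>
    rw [wedge_zero, vacKet, stateKet, psiDag_ket_of_notMem, map_zero]
    · simp
    · rw [mem_ofPartition_bot]
      omega
  | succ p ih =>
    rw [wedge_succ, psi_psiDag_psiVec, ih, Fin.sum_univ_succ, map_sum, add_comm]
    congr 1
    · rw [wedge_succ, Function.update_self, Fin.tail_update_zero]
    · refine Finset.sum_congr rfl fun i _ => ?_
      rw [wedge_succ, Fin.tail_update_succ, Function.update_of_ne (Fin.succ_ne_zero i).symm]
      rfl

/-- Every other factor has zero component at `b`, so a single term remains. The moved particle keeps
its position in the wedge, hence no sign. -/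
theorem psi_psiDag_wedge_single (a b : ℤ) (p : ℕ) (m : ℤ) (hb : m ≤ b) (c : Fin p → ℤ) (i : Fin p)
    (hi : c i = b) (hne : ∀ j, j ≠ i → c j ≠ b) :
    psi a (psiDag b (wedge p m fun j => Finsupp.single (c j) (1 : R))) =
      wedge p m fun j => Finsupp.single (Function.update c i a j) 1 := by
  rw [psi_psiDag_wedge a b p m hb, Finset.sum_eq_single i]
  · congr 1
    funext j
    rcases eq_or_ne j i with rfl | hj
    · simp [hi]
    · simp [hj]
  · intro j _ hj
    refine AlternatingMap.map_coord_zero _ j ?_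
    simp [hne j hj]
  · simp

/-! ### States with given Frobenius indices -/

/-- The state obtained from the vacuum of charge `n` by moving particles from the sites
`n - 1 - b i` to the sites `n + a i`, `i < r`. -/
def frobMaya (n : ℤ) (a b : ℕ → ℕ) : ℕ → Maya
  | 0 => Maya.ofPartition ⊥ n
  | r + 1 => ((frobMaya n (fun i => a (i + 1)) (fun i => b (i + 1)) r).remove (n - 1 - b 0)).add
      (n + a 0)

/-- The sites of the particles of `frobMaya n a b r`, where each moved particle keeps its place in
the vacuum ordering. -/
def frobSite (n : ℤ) (a b : ℕ → ℕ) : ℕ → ℕ → ℤ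
  | 0 => fun j => n - 1 - j
  | r + 1 => Function.update (frobSite n (fun i => a (i + 1)) (fun i => b (i + 1)) r) (b 0)
      (n + a 0)

theorem frobSite_of_ne (n : ℤ) (a b : ℕ → ℕ) (r j : ℕ) (hj : ∀ i < r, b i ≠ j) :
    frobSite n a b r j = n - 1 - j := by
  induction r generalizing a b with
  | zero => rfl
  | succ r ih =>
    rw [frobSite, Function.update_of_ne (hj 0 (Nat.succ_pos r)).symm]
    exact ih _ _ fun i hi => hj (i + 1) (by omega)

theorem frobSite_apply (n : ℤ) (a b : ℕ → ℕ) (r i : ℕ) (hi : i < r)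
    (hb : ∀ i j, i < j → j < r → b j < b i) : frobSite n a b r (b i) = n + a i := by
  induction r generalizing a b i with
  | zero => omega
  | succ r ih =>
    rw [frobSite]
    rcases Nat.eq_zero_or_pos i with rfl | h
    · rw [Function.update_self]
    -- The outermost update belongs to index `0`; strict decrease of `b` keeps it from overwriting
    -- the others.
    · rw [Function.update_of_ne (hb 0 i h hi).ne]
      obtain ⟨k, rfl⟩ := Nat.exists_eq_add_of_le' h
      exact ih (fun i => a (i + 1)) (fun i => b (i + 1)) k (by omega)
        fun i j hij hj => hb (i + 1) (j + 1) (by omega) (by omega)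

theorem mem_frobMaya (n : ℤ) (a b : ℕ → ℕ) (r : ℕ) (k : ℤ) :
    k ∈ (frobMaya n a b r).occ ↔
      (∃ i < r, k = n + a i) ∨ (k < n ∧ ∀ i < r, k ≠ n - 1 - b i) := by
  induction r generalizing a b with
  | zero => simp [frobMaya, mem_ofPartition_bot]
  | succ r ih =>
    rw [frobMaya, Maya.mem_add, Maya.mem_remove, ih]
    constructor
    · rintro (rfl | ⟨⟨i, hi, rfl⟩ | ⟨h1, h2⟩, h3⟩)
      · exact Or.inl ⟨0, by omega, rfl⟩
      · exact Or.inl ⟨i + 1, by omega, rfl⟩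
      · refine Or.inr ⟨h1, fun i hi => ?_⟩
        rcases Nat.eq_zero_or_pos i with rfl | h
        · exact h3
        · obtain ⟨i, rfl⟩ := Nat.exists_eq_add_of_le' h
          exact h2 i (by omega)
    · rintro (⟨i, hi, rfl⟩ | ⟨h1, h2⟩)
      · rcases Nat.eq_zero_or_pos i with rfl | h
        · exact Or.inl rfl
        · obtain ⟨i, rfl⟩ := Nat.exists_eq_add_of_le' h
          exact Or.inr ⟨Or.inl ⟨i, by omega, rfl⟩, by omega⟩
      · exact Or.inr ⟨Or.inr ⟨h1, fun i hi => h2 (i + 1) (by omega)⟩, h2 0 (by omega)⟩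

/-- Every move starts above `n - 1 - k` and ends higher still, so the count is that of the vacuum.
-/
theorem above_frobMaya (n : ℤ) (a b : ℕ → ℕ) (r k : ℕ) (hk : ∀ i < r, b i < k)
    (ha : ∀ i j, i < j → j < r → a j < a i) (hb : ∀ i j, i < j → j < r → b j < b i) :
    (frobMaya n a b r).above (n - 1 - k) = k := by
  induction r generalizing a b with
  | zero =>
    rw [frobMaya, above_ofPartition_bot (by omega)]
    omega
  | succ r ih =>
    have ha' : ∀ i j, i < j → j < r → a (j + 1) < a (i + 1) :=
      fun i j hij hj => ha _ _ (by omega) (by omega)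
    have hb' : ∀ i j, i < j → j < r → b (j + 1) < b (i + 1) :=
      fun i j hij hj => hb _ _ (by omega) (by omega)
    have hIH := ih (fun i => a (i + 1)) (fun i => b (i + 1)) (fun i hi => hk _ (by omega)) ha' hb'
    rw [frobMaya]
    set S := frobMaya n (fun i => a (i + 1)) (fun i => b (i + 1)) r with hS
    have h1 : n - 1 - b 0 ∈ S.occ := by
      rw [hS, mem_frobMaya]
      refine Or.inr ⟨by omega, fun i hi h => ?_⟩
      have := hb 0 (i + 1) (by omega) (by omega)
      omega
    have h2 : n + a 0 ∉ (S.remove (n - 1 - b 0)).occ := by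
      rw [Maya.mem_remove, hS, mem_frobMaya]
      rintro ⟨⟨i, hi, h⟩ | ⟨h, -⟩, -⟩
      · have := ha 0 (i + 1) (by omega) (by omega)
        omega
      · omega
    have h3 := Maya.above_remove h1 (n - 1 - k)
    have h4 := hk 0 (by omega)
    rw [if_pos (by omega), hIH] at h3
    rw [Maya.above_add h2, if_pos (by omega)]
    omega

/-- Index `0` has the largest `a` and `b` and is moved last. Its annihilation passes `b 0` particles
by `above_frobMaya`, and its creation at the top passes none, so each move contributes `(-1) ^ b i`.
-/
theorem wedge_frobSite (m n : ℤ) (p : ℕ) (hn : n = m + p) (a b : ℕ → ℕ) (r : ℕ)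
    (ha : ∀ i j, i < j → j < r → a j < a i) (hb : ∀ i j, i < j → j < r → b j < b i)
    (hp : ∀ i < r, b i < p) :
    wedge p m (fun j => Finsupp.single (frobSite n a b r j) (1 : R)) =
      (-1 : R) ^ (∑ i ∈ Finset.range r, b i) • ket (frobMaya n a b r) := by
  induction r generalizing a b with
  | zero =>
    simp only [frobSite, frobMaya, Finset.range_zero, Finset.sum_empty, pow_zero, one_smul]
    exact wedge_vacuum p m n hn
  | succ r ih =>
    have ha' : ∀ i j, i < j → j < r → a (j + 1) < a (i + 1) :=
      fun i j hij hj => ha _ _ (by omega) (by omega)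
    have hb' : ∀ i j, i < j → j < r → b (j + 1) < b (i + 1) :=
      fun i j hij hj => hb _ _ (by omega) (by omega)
    have hb0 : ∀ i < r, b (i + 1) < b 0 := fun i hi => hb _ _ (by omega) (by omega)
    have hIH := ih (fun i => a (i + 1)) (fun i => b (i + 1)) ha' hb'
      fun i hi => hp _ (by omega)
    have hab := above_frobMaya n (fun i => a (i + 1)) (fun i => b (i + 1)) r (b 0) hb0 ha' hb'
    have hp0 := hp 0 (by omega)
    rw [frobMaya, frobSite]
    set S := frobMaya n (fun i => a (i + 1)) (fun i => b (i + 1)) r with hS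
    set c := frobSite n (fun i => a (i + 1)) (fun i => b (i + 1)) r with hc
    have h1 : n - 1 - b 0 ∈ S.occ := by
      rw [hS, mem_frobMaya]
      refine Or.inr ⟨by omega, fun i hi h => ?_⟩
      have := hb0 i hi
      omega
    have h2 : ∀ k ∈ (S.remove (n - 1 - b 0)).occ, k < n + a 0 := by
      intro k
      rw [Maya.mem_remove, hS, mem_frobMaya]
      rintro ⟨⟨i, hi, h⟩ | ⟨h, -⟩, -⟩
      · have := ha 0 (i + 1) (by omega) (by omega)
        omega
      · omega
    have hci : c (b 0) = n - 1 - b 0 :=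
      frobSite_of_ne n _ _ r (b 0) fun i hi => (hb0 i hi).ne
    have hcj : ∀ j, j ≠ b 0 → c j ≠ n - 1 - b 0 := by
      intro j hj
      by_cases h : ∃ i < r, b (i + 1) = j
      · obtain ⟨i, hi, rfl⟩ := h
        rw [hc, frobSite_apply n (fun i => a (i + 1)) (fun i => b (i + 1)) r i hi hb']
        omega
      · push Not at h
        rw [hc, frobSite_of_ne n _ _ r j h]
        omega
    have hmove := psi_psiDag_wedge_single (R := R) (n + a 0) (n - 1 - b 0) p m (by omega)
      (fun j : Fin p => c j) ⟨b 0, hp0⟩ hci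
      fun j hj => hcj j fun h => hj (Fin.ext h)
    have hfun : (fun j : Fin p => Finsupp.single (Function.update c (b 0) (n + a 0) j) (1 : R)) =
        fun j : Fin p => Finsupp.single
          (Function.update (fun j : Fin p => c j) ⟨b 0, hp0⟩ (n + a 0) j) 1 := by
      funext j
      simp only [Function.update_apply, Fin.ext_iff]
    rw [hfun, ← hmove, hIH, map_smul, map_smul, psiDag_ket_of_mem h1, map_smul,
      psi_ket_of_notMem (fun h => lt_irrefl _ (h2 _ h)), hab,
      Maya.above_eq_zero fun k hk => (h2 k hk).le, pow_zero, one_smul, smul_smul, ← pow_add,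
      Finset.sum_range_succ']

/-! ### Frobenius indices of partitions -/

/-- The diagonal cells form an initial segment, so their number is the first index off the diagram.
-/
theorem lt_frobRank {lam : YoungDiagram} {i : ℕ} : i < frobRank lam ↔ (i, i) ∈ lam := by
  have hD : ∀ k, k ∈ (lam.cells.filter fun c => c.1 = c.2).image Prod.fst ↔ (k, k) ∈ lam := by
    intro k
    simp only [Finset.mem_image, Finset.mem_filter, YoungDiagram.mem_cells, Prod.exists]
    constructor
    · rintro ⟨x, y, ⟨h, h'⟩, rfl⟩
      subst h'
      exact h
    · exact fun h => ⟨k, k, ⟨h, rfl⟩, rfl⟩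
  have hcard : frobRank lam = ((lam.cells.filter fun c => c.1 = c.2).image Prod.fst).card := by
    rw [Finset.card_image_of_injOn, frobRank]
    rintro ⟨x, y⟩ hx ⟨x', y'⟩ hx' h
    simp only [Finset.coe_filter, Set.mem_ofPred_eq] at hx hx' h
    grind
  rw [hcard, ← hD]
  generalize (lam.cells.filter fun c => c.1 = c.2).image Prod.fst = D at hD
  have hlower : ∀ k ∈ D, ∀ l ≤ k, l ∈ D := fun k hk l hl =>
    (hD l).2 (lam.up_left_mem hl hl ((hD k).1 hk))
  constructor
  · intro h
    by_contra hi
    have hsub : D ⊆ Finset.range i := fun k hk => by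
      rw [Finset.mem_range]
      by_contra hki
      exact hi (hlower k hk i (not_lt.1 hki))
    have := Finset.card_le_card hsub
    rw [Finset.card_range] at this
    omega
  · intro h
    have hsub : Finset.range (i + 1) ⊆ D := fun k hk =>
      hlower i h k (Nat.lt_succ_iff.1 (Finset.mem_range.1 hk))
    have := Finset.card_le_card hsub
    rw [Finset.card_range] at this
    omega

theorem lt_rowLen_of_lt_frobRank {lam : YoungDiagram} {i : ℕ} (h : i < frobRank lam) :
    i < lam.rowLen i := YoungDiagram.mem_iff_lt_rowLen.1 (lt_frobRank.1 h)

theorem lt_colLen_of_lt_frobRank {lam : YoungDiagram} {i : ℕ} (h : i < frobRank lam) :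
    i < lam.colLen i := YoungDiagram.mem_iff_lt_colLen.1 (lt_frobRank.1 h)

theorem frobArm_lt (lam : YoungDiagram) (i j : ℕ) (hij : i < j) (hj : j < frobRank lam) :
    frobArm lam j < frobArm lam i := by
  have h1 := lt_rowLen_of_lt_frobRank hj
  have h2 := lam.rowLen_anti i j hij.le
  unfold frobArm
  omega

theorem frobLeg_lt (lam : YoungDiagram) (i j : ℕ) (hij : i < j) (hj : j < frobRank lam) :
    frobLeg lam j < frobLeg lam i := by
  have h1 := lt_colLen_of_lt_frobRank hj
  have h2 := lam.colLen_anti i j hij.le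
  unfold frobLeg
  omega

theorem frobLeg_lt_colLen (lam : YoungDiagram) (i : ℕ) (hi : i < frobRank lam) :
    frobLeg lam i < lam.colLen 0 := by
  have h1 := lt_colLen_of_lt_frobRank hi
  have h2 := lam.colLen_anti 0 i (Nat.zero_le i)
  unfold frobLeg
  omega

theorem lt_rowLen_iff_lt_colLen (lam : YoungDiagram) (i j : ℕ) :
    j < lam.rowLen i ↔ i < lam.colLen j :=
  YoungDiagram.mem_iff_lt_rowLen.symm.trans YoungDiagram.mem_iff_lt_colLen

/-- Take the least `i` with `λ_i + k ≤ i`. If equality failed, then with `i = l + 1` the column `l -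
k` would end exactly in row `l`, and its leg would be `k`. Thus a site below `n` that is not a
Frobenius hole is occupied. -/
theorem exists_eq_rowLen_add {lam : YoungDiagram} {k : ℕ}
    (h : ∀ i < frobRank lam, k ≠ frobLeg lam i) : ∃ i, i = lam.rowLen i + k := by
  have hex : ∃ i, lam.rowLen i + k ≤ i :=
    ⟨lam.rowLen 0 + k, Nat.add_le_add_right (lam.rowLen_anti 0 _ (Nat.zero_le _)) k⟩
  classical
  have hi := Nat.find_spec hex
  have hmin := fun l => Nat.find_min hex (m := l)
  generalize Nat.find hex = i at hi hmin
  refine ⟨i, ?_⟩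
  by_contra hne
  obtain ⟨l, rfl⟩ : ∃ l, i = l + 1 := Nat.exists_eq_add_of_le' (by omega)
  have hl := hmin l (by omega)
  have h1 := (lt_rowLen_iff_lt_colLen lam l (l - k)).1 (by omega)
  have h2 := mt (lt_rowLen_iff_lt_colLen lam (l + 1) (l - k)).2 (by omega)
  refine h (l - k) (lt_frobRank.2 (lam.up_left_mem (by omega) le_rfl
    (YoungDiagram.mem_iff_lt_colLen.2 h1))) ?_
  unfold frobLeg
  omega

/-- Rows meeting the diagonal give the particles at `n + α_i`; the remaining rows give sites below
`n`, missing precisely the sites `n - 1 - β_j`. -/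
theorem ofPartition_eq_frobMaya (lam : YoungDiagram) (n : ℤ) :
    Maya.ofPartition lam n = frobMaya n (frobArm lam) (frobLeg lam) (frobRank lam) := by
  ext s
  rw [mem_frobMaya]
  simp only [Maya.ofPartition, Set.mem_range]
  constructor
  · rintro ⟨i, rfl⟩
    by_cases hi : i < frobRank lam
    · have h1 := lt_rowLen_of_lt_frobRank hi
      refine Or.inl ⟨i, hi, ?_⟩
      unfold frobArm
      omega
    · have h1 : ¬ i < lam.rowLen i := fun h =>
        hi (lt_frobRank.2 (YoungDiagram.mem_iff_lt_rowLen.2 h))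
      refine Or.inr ⟨by omega, fun j hj h => ?_⟩
      have h2 := lt_colLen_of_lt_frobRank hj
      have h3 := lt_rowLen_iff_lt_colLen lam i j
      unfold frobLeg at h
      omega
  · rintro (⟨i, hi, rfl⟩ | ⟨hs, h⟩)
    · have h1 := lt_rowLen_of_lt_frobRank hi
      refine ⟨i, ?_⟩
      unfold frobArm
      omega
    · obtain ⟨i, hi⟩ := exists_eq_rowLen_add (lam := lam) (k := (n - 1 - s).toNat)
        fun i hi hk => h i hi (by omega)
      exact ⟨i, by omega⟩

/-! ### Hooks. -/

theorem mem_hook {a b i j : ℕ} : (i, j) ∈ hook a b ↔ i = 0 ∧ j ≤ a ∨ i ≤ b ∧ j = 0 := by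
  rw [hook, YoungDiagram.mem_ofRowLens]
  cases i with
  | zero =>
    simp only [List.length_cons, List.length_replicate, List.getElem_cons_zero]
    constructor
    · rintro ⟨-, h⟩
      exact Or.inl ⟨trivial, by omega⟩
    · exact fun h => ⟨by omega, by omega⟩
  | succ i =>
    simp only [List.length_cons, List.length_replicate, List.getElem_cons_succ,
      List.getElem_replicate]
    constructor
    · rintro ⟨h, h'⟩
      exact Or.inr ⟨by omega, by omega⟩
    · exact fun h => ⟨by omega, by omega⟩

theorem frobRank_hook (a b : ℕ) : frobRank (hook a b) = 1 := by
  have h0 : 0 < frobRank (hook a b) := lt_frobRank.2 (mem_hook.2 (by omega))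
  have h1 : ¬ 1 < frobRank (hook a b) := fun h => by
    have := mem_hook.1 (lt_frobRank.1 h)
    omega
  omega

theorem frobArm_hook (a b : ℕ) : frobArm (hook a b) 0 = a := by
  have h1 : a < (hook a b).rowLen 0 := YoungDiagram.mem_iff_lt_rowLen.1 (mem_hook.2 (by omega))
  have h2 : ¬ a + 1 < (hook a b).rowLen 0 := fun h => by
    have := mem_hook.1 (YoungDiagram.mem_iff_lt_rowLen.2 h)
    omega
  unfold frobArm
  omega

theorem frobLeg_hook (a b : ℕ) : frobLeg (hook a b) 0 = b := by
  have h1 : b < (hook a b).colLen 0 := YoungDiagram.mem_iff_lt_colLen.1 (mem_hook.2 (by omega))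
  have h2 : ¬ b + 1 < (hook a b).colLen 0 := fun h => by
    have := mem_hook.1 (YoungDiagram.mem_iff_lt_colLen.2 h)
    omega
  unfold frobLeg
  omega

theorem ofPartition_hook (a b : ℕ) (n : ℤ) :
    Maya.ofPartition (hook a b) n = frobMaya n (fun _ => a) (fun _ => b) 1 := by
  rw [ofPartition_eq_frobMaya, frobRank_hook]
  simp only [frobMaya, frobArm_hook, frobLeg_hook]

/-! ### The Giambelli identity -/

/-- If `u` arises from the rows `u₀` of a unimodular matrix by replacing the rows `b i`, its
determinant is the determinant of the matrix of all single replacements. -/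
theorem det_replace_rows {p r : ℕ} (u₀ u : Fin p → Fin p → R) (h₀ : (Matrix.of u₀).det = 1)
    (b : Fin r → Fin p) (hb : Function.Injective b) (hu : ∀ i, (∀ k, b k ≠ i) → u i = u₀ i) :
    (Matrix.of u).det =
      Matrix.det (Matrix.of fun i j : Fin r => ((Matrix.of u₀).updateRow (b j) (u (b i))).det) := by
  classical
  -- Row `i` of `C` holds the coordinates of `u i` in the basis formed by the rows of `u₀`.
  let C : Matrix (Fin p) (Fin p) R := Matrix.of fun i => (Matrix.of u₀).transpose.cramer (u i)
  have hC : C * Matrix.of u₀ = Matrix.of u := by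
    ext i j
    have h := congrFun (Matrix.mulVec_cramer (Matrix.of u₀).transpose (u i)) j
    rw [Matrix.det_transpose, h₀, one_smul, Matrix.mulVec_transpose] at h
    exact h
  have hCi : ∀ i, (∀ k, b k ≠ i) → ∀ j, C i j = if i = j then 1 else 0 := fun i hi j => by
    have h := congrFun (Matrix.cramer_transpose_row_self (Matrix.of u₀) i) j
    rw [h₀, Pi.single_apply] at h
    simp only [C, Matrix.of_apply, hu i hi, eq_comm (a := i)]
    exact h
  have hdet : (Matrix.of u).det = C.det := by rw [← hC, Matrix.det_mul, h₀, mul_one]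
  -- Unreplaced rows of `C` are rows of the identity, so `C` is block triangular and only the block
  -- on the range of `b` contributes.
  have h1 : (C.toSquareBlockProp fun i => ¬ i ∈ Set.range b) = 1 := by
    ext ⟨i, hi⟩ ⟨j, hj⟩
    rw [Matrix.toSquareBlockProp_def, Matrix.of_apply, hCi i fun k hk => hi ⟨k, hk⟩,
      Matrix.one_apply]
    simp
  have h2 : (C.toSquareBlockProp fun i => i ∈ Set.range b).submatrix (Equiv.ofInjective b hb)
      (Equiv.ofInjective b hb) =
        Matrix.of fun i j : Fin r => ((Matrix.of u₀).updateRow (b j) (u (b i))).det := by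
    ext i j
    -- Cramer's rule: the coordinate along row `b j` is the determinant with that row replaced.
    rw [Matrix.submatrix_apply, Matrix.toSquareBlockProp_def, Matrix.of_apply, Matrix.of_apply,
      Equiv.ofInjective_apply, Equiv.ofInjective_apply, ← Matrix.cramer_transpose_apply]
    rfl
  rw [hdet, Matrix.twoBlockTriangular_det C (fun i => i ∈ Set.range b), h1, Matrix.det_one,
    mul_one, ← h2, Matrix.det_submatrix_equiv_self]
  · congr!
  · intro i hi j hj
    rw [hCi i fun k hk => hi ⟨k, hk⟩, if_neg]
    rintro rfl
    exact hi hj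

variable [Algebra ℚ R]

theorem tau_eq_det {A : Matrix ℤ ℤ R} (hA : ∀ i j : ℤ, j ≤ i → A i j = 0) (t : ℕ+ → R)
    (n : ℤ) (p : ℕ) (a b : ℕ → ℕ) (r : ℕ)
    (ha : ∀ i j, i < j → j < r → a j < a i) (hb : ∀ i j, i < j → j < r → b j < b i)
    (hp : ∀ i < r, b i < p) (lam : YoungDiagram) (hlam : Maya.ofPartition lam n = frobMaya n a b r) :
    tau A lam n t = (-1 : R) ^ (∑ i ∈ Finset.range r, b i) *
      Matrix.det (Matrix.of fun j : Fin p =>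
        vacCoord p n (groupVec A t (n - p) (Finsupp.single (frobSite n a b r j) 1))) := by
  rw [← vacBra_wedge p (n - p) n (by ring), ← gammaPlus_gHat_wedge hA,
    wedge_frobSite (n - p) n p (by ring) a b r ha hb hp, map_smul, map_smul, smul_eq_mul,
    ← mul_assoc, ← mul_pow, neg_one_mul, neg_neg, one_pow, one_mul, tau, stateKet, hlam]

theorem tau_giambelli {A : Matrix ℤ ℤ R} (hA : ∀ i j : ℤ, j ≤ i → A i j = 0) (n : ℤ)
    (lam : YoungDiagram) (t : ℕ+ → R) :
    tau A lam n t = Matrix.det (Matrix.of fun i j : Fin (frobRank lam) =>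
      tau A (hook (frobArm lam i) (frobLeg lam j)) n t) := by
  -- The number of parts of `lam` exceeds every leg, so all holes lie among the top `p` vacuum
  -- sites; the same `p` serves for every hook involved.
  set p := lam.colLen 0
  set a := frobArm lam
  set b := frobLeg lam
  set r := frobRank lam
  have ha : ∀ i j, i < j → j < r → a j < a i := frobArm_lt lam
  have hb : ∀ i j, i < j → j < r → b j < b i := frobLeg_lt lam
  have hp : ∀ i < r, b i < p := frobLeg_lt_colLen lam
  let row : ℤ → Fin p → R := fun k =>
    vacCoord p n (groupVec A t (n - p) (Finsupp.single k 1))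
  let u₀ : Fin p → Fin p → R := fun j => row (n - 1 - (j : ℕ))
  let u : Fin p → Fin p → R := fun j => row (frobSite n a b r j)
  let q : Fin r → Fin p := fun i => ⟨b i, hp i i.2⟩
  have hq : Function.Injective q := by
    intro i j hij
    have h : b i = b j := congrArg Fin.val hij
    rcases lt_trichotomy i j with h' | h' | h'
    · exact absurd h (hb i j h' j.2).ne'
    · exact h'
    · exact absurd h (hb j i h' i.2).ne
  -- This determinant is `⟨n| G |n⟩`, and `G` fixes the vacuum.
  have hu₀ : (Matrix.of u₀).det = 1 := by
    rw [← vacBra_vacKet (R := R) n, ← gammaPlus_gHat_vacKet t n hA,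
      ← wedge_vacuum p (n - p) n (by ring), gammaPlus_gHat_wedge hA,
      vacBra_wedge p (n - p) n (by ring)]
  have hu : ∀ i, (∀ k, q k ≠ i) → u i = u₀ i := fun i hi => by
    simp only [u, u₀]
    rw [frobSite_of_ne]
    exact fun k hk h => hi ⟨k, hk⟩ (Fin.ext h)
  have huq : ∀ i, u (q i) = row (n + a i) := fun i => by
    simp only [u, q]
    rw [frobSite_apply n a b r i i.2 hb]
  have hhook : ∀ i j : Fin r, tau A (hook (a i) (b j)) n t =
      (-1 : R) ^ b j * ((Matrix.of u₀).updateRow (q j) (u (q i))).det := fun i j => by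
    rw [tau_eq_det hA t n p (fun _ => a i) (fun _ => b j) 1 (by omega) (by omega)
      (fun _ _ => hp j j.2) _ (ofPartition_hook _ _ n), huq]
    simp only [Finset.range_one, Finset.sum_singleton, frobSite]
    congr 2
    ext k l
    rw [Matrix.updateRow_apply]
    simp only [Matrix.of_apply, Function.update_apply, q, Fin.ext_iff]
    split_ifs <;> rfl
  simp only [hhook]
  -- The hook sign depends only on the column `j`; pulled out of the determinant, the signs multiply
  -- to the sign of `lam`.
  refine Eq.trans ?_ (Matrix.det_mul_row (fun j : Fin r => (-1 : R) ^ b j)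
    (Matrix.of fun i j : Fin r => ((Matrix.of u₀).updateRow (q j) (u (q i))).det)).symm
  rw [← det_replace_rows u₀ u hu₀ q hq hu, Finset.prod_pow_eq_pow_sum,
    Fin.sum_univ_eq_sum_range b r]
  exact tau_eq_det hA t n p a b r ha hb hp lam (ofPartition_eq_frobMaya lam n)

end Fermi

end

theorem proposition3p2 {R : Type*} [CommRing R] [Algebra ℚ R]
    (A : Matrix ℤ ℤ R) (hA : ∀ i j : ℤ, j ≤ i → A i j = 0)
    (n : ℤ) {N : ℕ} (x : Fin N → R) (lam : YoungDiagram) :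
    Fermi.tau A lam n (Fermi.powerSums x) =
      Matrix.det (Matrix.of fun i j : Fin (Fermi.frobRank lam) =>
        Fermi.tau A (Fermi.hook (Fermi.frobArm lam i) (Fermi.frobLeg lam j)) n
          (Fermi.powerSums x)) :=
  Fermi.tau_giambelli hA n lam (Fermi.powerSums x)
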